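/- Let $N\ge 1$ and let $T\ge 2N$ be even. Write $(a)^+=\max\{a,0\}$, $f(n,m)=n^2-((n-m)^+)^2$ and $L=TN-N^2+1$. Call a family of $T\times N$ complex matrices $A_{g,j}$ ($g=1,2$, $1\le j\le L$), each split into an upper and a lower half $V_1,V_2\in\mathbb C^{\frac T2\times N}$, a *two-group code of Ren et al. type* if (i) all $K=2L$ matrices $A_{g,j}$ are linearly independent over $\mathbb R$; (ii) there are semi-unitary $F_1,F_2\in\mathbb C^{\frac T2\times N}$ ($F_k^HF_k=I_N$) such that $V_k=\pm F_k$ for every matrix of group $k$; (iii) for $k=1,2$, the $k$-th halves $V,V'$ of any two matrices of different groups are Hurwitz-Radon orthogonal, $V^HV'+V'^HV=0$. For a channel matrix $H\in\mathbb C^{N\times M}$, $M\ge1$, with i.i.d. zero mean, unit variance, circularly symmetric complex Gaussian entries, let $G\in\mathbb R^{2MT\times K}$ be the equivalent channel matrix, whose columns are the vectors $\widetilde{vec}(A_{g,j}H)$ (real parts, then imaginary parts, of the stacked columns of $A_{g,j}H$), and let $G_1,G_2$ be its submatrices that belong to the two groups. The rate is $R=\frac{K}{2T}$. For $M\ge R$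 the code is *singular* for $M$ receive antennas if $rank(G)<K$ with probability $1$, and *non-singular* otherwise. *Decoder.* The symbols $s_g$ of group $g$ range over $\mathcal A_q^L$ with $\mathcal A_q=\{-(q-1),-(q-3),\dots,q-1\}$, $x_g=\Theta_gs_g$ with invertible real $\Theta_g$, and $Y=XH+W$ is received, where $X=\sum_{g,j}(x_g)_jA_{g,j}$ and the entries of $W$ are i.i.d. zero mean, unit variance, circularly symmetric complex Gaussian. Each group is decoded separately with $y=\widetilde{vec}(Y)$: take a QR decomposition $G_g\Theta_g=Q[R_a\ R_b]$, after a permutation of the columns, with $Q^TQ=I$ and $R_a$ upper triangular with non-zero diagonal. For each value of $s_b$ in the constellation, list by the triangular tree search all $s_a$ with $\|Q^Ty-R_bs_b-R_as_a\|\le\rho$. Start with $\rho=\rho_0>0$, double $\rho$ as long as nothing is found for any $s_b$, and put out the best vector found. The complexity is the total number of tree nodes visited by the decoders of both groups. Then two-group codes of Ren et al. type exist for all such $N,T$, and every one of them has the following properties. 1. $R=N-\frac{N^2-1}{T}$. 2. If $1\le M<N$, then with probability $1$ both $rank(G_1)$ and $rank(G_2)$ equal $(T-2N)M+f(N,M)+1$.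 3. For $M\ge1$ the code is singular for $M$ receive antennas if and only if $\lceil R\rceil\le M<N$, and (with $M\ge R$) non-singular if and only if $M\ge N$. 4. For $M\ge1$, with probability $1$ over $H$: for all invertible $\Theta_1,\Theta_2$, QR decompositions as above exist, and for any choice of them and of $\rho_0>0$ the decoder returns for every $Y$ and every $q\ge1$ a joint maximum likelihood estimate of the symbols of both groups, and there is a constant $C$, independent of $q$ and of the transmitted symbols (it may depend on $H$, $\Theta_1,\Theta_2$, the decompositions and $\rho_0$), such that the complexity averaged over the noise is at most $C\,q^{(N-M)^+\cdot(T-N-M)}$ for all $q\ge 1$; that is, $O(q^{(N-M)(T-N-M)})$ for $M<N$. -/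

import Mathlib

open MeasureTheory ProbabilityTheory
open scoped Matrix NNReal ENNReal

namespace STBC

noncomputable section

/-! ### Channel model -/

/-- The law of a zero mean, unit variance, circularly symmetric complex Gaussian variable: real and
imaginary part are independent, centred Gaussians of variance `1 / 2`. -/
def complexGaussian : Measure ℂ :=
  ((gaussianReal 0 (1 / 2)).prod (gaussianReal 0 (1 / 2))).map (fun p : ℝ × ℝ => (⟨p.1, p.2⟩ : ℂ))

instance {m n : Type*} : MeasurableSpace (Matrix m n ℂ) :=
  inferInstanceAs (MeasurableSpace (m → n → ℂ))

/-- The law of a random matrix whose entries are i.i.d. zero mean, unit variance, circularly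
symmetric complex Gaussian: the law of the channel matrix and the law of the noise matrix. -/
def gaussianMatrix (m n : Type*) [Fintype m] [Fintype n] : Measure (Matrix m n ℂ) :=
  Measure.pi fun _ : m => Measure.pi fun _ : n => complexGaussian

/-- Stack the columns of `X`, first all real parts and then all imaginary parts. -/
def vecTilde {m n : Type*} (X : Matrix m n ℂ) : (n × m) ⊕ (n × m) → ℝ :=
  Sum.elim (fun p => (X.vec p).re) (fun p => (X.vec p).im)

/-- The equivalent channel matrix of the weight matrices `A` for the channel realization `H`: its
`k`-th column is `vecTilde (A k * H)`. -/
def equivChannel {τ ι : Type*} {N M : ℕ} (A : ι → Matrix τ (Fin N) ℂ)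
    (H : Matrix (Fin N) (Fin M) ℂ) : Matrix ((Fin M × τ) ⊕ (Fin M × τ)) ι ℝ :=
  Matrix.of fun p k => vecTilde (A k * H) p

/-- The code rate `K / (2 T)` in complex symbols per channel use, where `K` is the number of weight
matrices and `T` the number of their rows. -/
def rate {τ ι : Type*} [Fintype τ] [Fintype ι] {N : ℕ} (_A : ι → Matrix τ (Fin N) ℂ) : ℝ :=
  (Fintype.card ι : ℝ) / (2 * (Fintype.card τ : ℝ))

/-- The equivalent channel matrix has rank less than `K` with probability one. -/
def RankDeficient {τ ι : Type*} [Fintype τ] [Fintype ι] {N : ℕ} (A : ι → Matrix τ (Fin N) ℂ)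
    (M : ℕ) : Prop :=
  ∀ᵐ H ∂(gaussianMatrix (Fin N) (Fin M)), (equivChannel A H).rank < Fintype.card ι

/-- Singularity for `M` receive antennas (a notion for `M ≥ R` only). -/
def IsSingular {τ ι : Type*} [Fintype τ] [Fintype ι] {N : ℕ} (A : ι → Matrix τ (Fin N) ℂ)
    (M : ℕ) : Prop :=
  rate A ≤ M ∧ RankDeficient A M

/-- Non-singularity for `M` receive antennas (a notion for `M ≥ R` only). -/
def IsNonsingular {τ ι : Type*} [Fintype τ] [Fintype ι] {N : ℕ} (A : ι → Matrix τ (Fin N) ℂ)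
    (M : ℕ) : Prop :=
  rate A ≤ M ∧ ¬ RankDeficient A M

/-- `f(n, m) = n² - ((n - m)⁺)²`; the truncated subtraction is the positive part. -/
def f (n m : ℕ) : ℕ := n ^ 2 - (n - m) ^ 2

/-! ### The family of codes -/

/-- The upper (`k = 0`) and the lower (`k = 1`) half of the rows. -/
def half {m n : Type*} (k : Fin 2) (X : Matrix (m ⊕ m) n ℂ) : Matrix m n ℂ :=
  ![X.toRows₁, X.toRows₂] k

/-- The two-group codes: `A (g, j)` is the `j`-th of the `T N - N² + 1` weight matrices of group
`g`. The `T` rows of a weight matrix are split into two halves of `T / 2` rows each. -/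
structure IsTwoGroupCode {N T : ℕ} (F : Fin 2 → Matrix (Fin (T / 2)) (Fin N) ℂ)
    (A : Fin 2 × Fin (T * N - N ^ 2 + 1) → Matrix (Fin (T / 2) ⊕ Fin (T / 2)) (Fin N) ℂ) :
    Prop where
  /-- the weight matrices of an STBC are linearly independent over the reals -/
  linearIndependent : LinearIndependent ℝ A
  /-- the constant matrices are semi-unitary -/
  semiunitary : ∀ k, (F k)ᴴ * F k = 1
  /-- in group `k` the `k`-th half is the constant matrix up to sign -/
  half_eq : ∀ k j, half k (A (k, j)) = F k ∨ half k (A (k, j)) = -F k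
  /-- each half of any two weight matrices of different groups is Hurwitz-Radon orthogonal -/
  orthogonal : ∀ k i j, (half k (A (0, i)))ᴴ * half k (A (1, j))
    + (half k (A (1, j)))ᴴ * half k (A (0, i)) = 0

/-- The codeword matrix of the integer symbols `s`: the real information symbols of group `g` are
`Θ g *ᵥ s g`. -/
def codeword {τ : Type*} {N L : ℕ} (A : Fin 2 × Fin L → Matrix τ (Fin N) ℂ)
    (Θ : Fin 2 → Matrix (Fin L) (Fin L) ℝ) (s : Fin 2 → Fin L → ℤ) : Matrix τ (Fin N) ℂ :=
  ∑ g, ∑ j, (Θ g *ᵥ fun i => (s g i : ℝ)) j • A (g, j)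

/-- The equivalent channel matrix of group `g`: a submatrix of that of the whole code. -/
def groupChannel {τ : Type*} {N M L : ℕ} (A : Fin 2 × Fin L → Matrix τ (Fin N) ℂ)
    (H : Matrix (Fin N) (Fin M) ℂ) (g : Fin 2) :
    Matrix ((Fin M × τ) ⊕ (Fin M × τ)) (Fin L) ℝ :=
  (equivChannel A H).submatrix id fun j => (g, j)

/-! ### The sphere decoder -/

/-- The regular PAM constellation `{-(q-1), -(q-3), …, q-1}` with `q` points. -/
def pam (q : ℕ) : Finset ℤ :=
  (Finset.range q).image fun j : ℕ => 2 * (j : ℤ) - ((q : ℤ) - 1)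

/-- The integer vectors with all entries in the constellation. -/
def signalSet (ι : Type*) [Fintype ι] [DecidableEq ι] (q : ℕ) : Finset (ι → ℤ) :=
  Fintype.piFinset fun _ => pam q

/-- The points of the constellation in the interval `[lo, hi]`, addressed directly through the
range of their indices. -/
def pamInterval (q : ℕ) (lo hi : ℝ) : Finset ℤ :=
  (Finset.Icc (max 0 ⌈(lo + ((q : ℝ) - 1)) / 2⌉) (min ((q : ℤ) - 1) ⌊(hi + ((q : ℝ) - 1)) / 2⌋)).image
    fun j => 2 * j - ((q : ℤ) - 1)

/-- A QR decomposition of `G`, whose columns are ordered such that `R = [Ra Rb]` with `Ra` upper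
triangular of full rank (so that the size `r` of `Ra` is the rank of `G`). -/
structure QR {m ι : Type*} [Fintype m] (G : Matrix m ι ℝ) where
  /-- number of columns of `Ra` -/
  r : ℕ
  /-- number of columns of `Rb` -/
  c : ℕ
  /-- the order of the columns -/
  order : Fin r ⊕ Fin c ≃ ι
  /-- the factor with orthonormal columns -/
  Q : Matrix m (Fin r) ℝ
  /-- the upper triangular part -/
  Ra : Matrix (Fin r) (Fin r) ℝ
  /-- the remaining columns -/
  Rb : Matrix (Fin r) (Fin c) ℝ
  orthonormal : Qᵀ * Q = 1
  upper : ∀ i j, j < i → Ra i j = 0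
  diag_ne_zero : ∀ i, Ra i i ≠ 0
  factorization : G.submatrix id order = Q * Matrix.fromCols Ra Rb

/-- Tree search for all `s` with entries in the constellation and `‖z - R s‖² ≤ b`, for an upper
triangular `R`. At a node of height `i` the entries of `s` with index at least `i` are fixed, and `b`
is what remains of the squared radius. The children of the node are the constellation points in the
interval to which the row `i - 1` confines the next entry. The search returns the vectors at the
leaves it reaches, and the number of nodes it visits. -/
def search {r : ℕ} (R : Matrix (Fin r) (Fin r) ℝ) (q : ℕ) (z : Fin r → ℝ) :
    (i : ℕ) → i ≤ r → (Fin r → ℤ) → ℝ → Finset (Fin r → ℤ) × ℕ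
  | 0, _, s, _ => ({s}, 1)
  | i + 1, h, s, b =>
    let k : Fin r := ⟨i, h⟩
    let e : ℝ := z k - ∑ j ∈ Finset.Ioi k, R k j * (s j : ℝ)
    let children := pamInterval q (e / R k k - √b / |R k k|) (e / R k k + √b / |R k k|)
    let sub := fun a : ℤ =>
      search R q z i (Nat.le_of_succ_le h) (Function.update s k a) (b - (e - R k k * (a : ℝ)) ^ 2)
    (children.biUnion fun a => (sub a).1, 1 + ∑ a ∈ children, (sub a).2)

namespace QR

variable {m ι : Type*} [Fintype m] {G : Matrix m ι ℝ}

/-- The tree search for the entries `s_a`, once the entries `s_b` are fixed and their interference is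
removed. -/
def condSearch (D : QR G) (q : ℕ) (y : m → ℝ) (ρ : ℝ) (sb : Fin D.c → ℤ) :
    Finset (Fin D.r → ℤ) × ℕ :=
  search D.Ra q ((D.Q)ᵀ *ᵥ y - D.Rb *ᵥ fun i => (sb i : ℝ)) D.r le_rfl 0 (ρ ^ 2)

/-- All symbol vectors that are found in the sphere of radius `ρ`, when the conditional search is
carried out for every value of `s_b`. -/
def found (D : QR G) (q : ℕ) (y : m → ℝ) (ρ : ℝ) :
    Finset ((Fin D.c → ℤ) × (Fin D.r → ℤ)) :=
  (signalSet (Fin D.c) q).biUnion fun sb => (D.condSearch q y ρ sb).1.image fun sa => (sb, sa)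

/-- The number of nodes visited for the radius `ρ`, over all values of `s_b`. -/
def nodes (D : QR G) (q : ℕ) (y : m → ℝ) (ρ : ℝ) : ℕ :=
  ∑ sb ∈ signalSet (Fin D.c) q, (D.condSearch q y ρ sb).2

/-- The sphere has radius `ρ₀` at first, and the radius is doubled as long as the sphere contains no
point: the number of doublings. -/
def doublings (D : QR G) (q : ℕ) (ρ₀ : ℝ) (y : m → ℝ) : ℕ :=
  sInf {n : ℕ | (D.found q y (2 ^ n * ρ₀)).Nonempty}

/-- The number of nodes that the sphere decoder visits in total. -/
def cost (D : QR G) (q : ℕ) (ρ₀ : ℝ) (y : m → ℝ) : ℕ :=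
  ∑ n ∈ Finset.range (D.doublings q ρ₀ y + 1), D.nodes q y (2 ^ n * ρ₀)

/-- The squared distance `‖Qᵀ y - Ra s_a - Rb s_b‖²`. -/
def metric (D : QR G) (y : m → ℝ) (p : (Fin D.c → ℤ) × (Fin D.r → ℤ)) : ℝ :=
  ∑ k, (((D.Q)ᵀ *ᵥ y - (D.Rb *ᵥ fun i => (p.1 i : ℝ)) - D.Ra *ᵥ fun i => (p.2 i : ℝ)) k) ^ 2

/-- The output of the sphere decoder: the best of the vectors found, in the original order of the
symbols. -/
def decode (D : QR G) (q : ℕ) (ρ₀ : ℝ) (y : m → ℝ) : Option (ι → ℤ) :=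
  ((D.found q y (2 ^ D.doublings q ρ₀ y * ρ₀)).toList.argmin (D.metric y)).map
    fun p i => Sum.elim p.2 p.1 (D.order.symm i)

end QR

/-- `s` is a maximum likelihood estimate of the symbols of both groups jointly, for the received
matrix `Y`: it minimizes the Frobenius norm of `Y - X H` over all codewords. -/
def IsMLEstimate {τ : Type*} [Fintype τ] {N M L : ℕ} (A : Fin 2 × Fin L → Matrix τ (Fin N) ℂ)
    (Θ : Fin 2 → Matrix (Fin L) (Fin L) ℝ) (q : ℕ) (H : Matrix (Fin N) (Fin M) ℂ)
    (Y : Matrix τ (Fin M) ℂ) (s : Fin 2 → Fin L → ℤ) : Prop :=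
  (∀ g, s g ∈ signalSet (Fin L) q) ∧
    ∀ s' : Fin 2 → Fin L → ℤ, (∀ g, s' g ∈ signalSet (Fin L) q) →
      ∑ t, ∑ j, ‖(Y - codeword A Θ s * H) t j‖ ^ 2 ≤
        ∑ t, ∑ j, ‖(Y - codeword A Θ s' * H) t j‖ ^ 2

end

end STBC

open STBC

namespace STBC

open Matrix

/-! ### Orthonormal complements -/

/-! Everything rests on one dimension count. Half `g` of a matrix of group `g` lies on the real line
through `F g`, and its other half lies in `hrSpace (F (g + 1))`, of real dimension `N² + 2(T/2 - N)N
= TN - N²`. The group has `TN - N² + 1` independent matrices, so its span is the whole product of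
these two spaces (`map_span_group`).

The rank of a group channel is the group size minus the dimension of the part of the span that `H`
annihilates (`rank_equivChannel_add`). Almost surely `H` has full rank. For `M ≥ N` nothing nonzero
is annihilated. For `M < N` the line through `F g` contributes nothing, and a Hurwitz-Radon
orthogonal matrix killed by `H` consists of a skew-Hermitian block of size `m = N - M` and a free
`(T/2 - N) × m` block (`finrank_of_mem_iff_hrSpace`). The kernel thus has dimension `m² + 2(T/2 -
N)m = (N - M)(T - N - M)`. This gives the ranks and the singularity criterion, and bounds the number
of symbols that the decoder must enumerate exhaustively.

Hurwitz-Radon orthogonality makes the columns of the two group channels orthogonal, so the joint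
metric is a sum of group metrics up to a constant, and each decoder is blind to the other group. The
transmitted vector has metric at most the squared noise norm, so the radius stops growing at a size
controlled by the noise. The constellation has spacing 2, so a tree search in a sphere of radius `ρ`
visits a number of nodes polynomial in `ρ`, independently of `q`. Only the enumeration of `s_b`
costs a power of `q`; the remaining polynomial in the noise has finite Gaussian mean
(`exists_cost_le`, `exists_complexity_le`). -/

open scoped ComplexOrder in
lemma exists_orthonormal_complement {n k : ℕ} (X : Matrix (Fin n) (Fin k) ℂ)
    (hX : Function.Injective X.mulVec) :
    ∃ P : Matrix (Fin n) (Fin (n - k)) ℂ, Pᴴ * P = 1 ∧ Xᴴ * P = 0 ∧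
      ∀ l (V : Matrix (Fin n) (Fin l) ℂ), Xᴴ * V = 0 → P * (Pᴴ * V) = V := by
  -- The columns of `P` will be an orthonormal basis of the kernel of `Xᴴ`, of dimension `n - k` by
  -- rank-nullity; the last claim is the expansion of each column of `V` in this basis.
  let p : Submodule ℂ (EuclideanSpace ℂ (Fin n)) := LinearMap.ker (Matrix.toEuclideanLin Xᴴ)
  have hmem : ∀ v : EuclideanSpace ℂ (Fin n), v ∈ p ↔ Xᴴ *ᵥ v.ofLp = 0 := by
    intro v
    simp only [p, LinearMap.mem_ker]
    rw [Matrix.toLpLin_apply]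
    simp
  have hdim : Module.finrank ℂ p = n - k := by
    have h1 := LinearMap.finrank_range_add_finrank_ker (Matrix.toEuclideanLin Xᴴ)
    have h2 : Module.finrank ℂ (LinearMap.range (Matrix.toEuclideanLin Xᴴ)) = k := by
      have h3 := Matrix.rank_conjTranspose X
      have h4 : X.rank = k := by
        have : Module.finrank ℂ (LinearMap.range X.mulVecLin) = _ :=
          LinearMap.finrank_range_of_inj (f := X.mulVecLin) hX
        simpa [Matrix.rank] using this
      have h5 := Matrix.rank_eq_finrank_range_toLin Xᴴ
        (EuclideanSpace.basisFun (Fin k) ℂ).toBasis (EuclideanSpace.basisFun (Fin n) ℂ).toBasis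
      rw [h3, h4] at h5
      rw [Matrix.toEuclideanLin_eq_toLin_orthonormal]
      exact h5.symm
    rw [h2, finrank_euclideanSpace_fin] at h1
    change k + Module.finrank ℂ p = n at h1
    omega
  let b := (stdOrthonormalBasis ℂ p).reindex (finCongr hdim)
  let P : Matrix (Fin n) (Fin (n - k)) ℂ := Matrix.of fun i j => (b j : EuclideanSpace ℂ (Fin n)) i
  refine ⟨P, ?_, ?_, ?_⟩
  · ext i j
    have h := (orthonormal_iff_ite.mp b.orthonormal) i j
    rw [Submodule.coe_inner, EuclideanSpace.inner_eq_star_dotProduct] at h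
    rw [Matrix.one_apply, ← h]
    simp [Matrix.mul_apply, P, dotProduct, mul_comm]
  · ext i j
    have h := congrFun ((hmem _).1 (b j).2) i
    simpa [Matrix.mul_apply, P, mulVec, dotProduct] using h
  · intro l V hV
    ext i j
    have hv : WithLp.toLp 2 (V.col j) ∈ p := by
      rw [hmem]
      ext a
      have := congrFun (congrFun hV a) j
      simpa [Matrix.mul_apply, mulVec, dotProduct] using this
    have h := b.sum_repr' ⟨_, hv⟩
    have h2 := congrArg (fun x : p => (x : EuclideanSpace ℂ (Fin n)) i) h
    simp only [Submodule.coe_inner, EuclideanSpace.inner_eq_star_dotProduct] at h2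
    simp only [Submodule.coe_sum, Submodule.coe_smul, WithLp.ofLp_sum, Finset.sum_apply,
      WithLp.ofLp_smul, Pi.smul_apply, smul_eq_mul] at h2
    simp only [Matrix.col_apply] at h2
    rw [← h2]
    simp only [Matrix.mul_apply, P, Matrix.of_apply, conjTranspose_apply, dotProduct]
    refine Finset.sum_congr rfl fun x _ => ?_
    rw [mul_comm]
    congr 1
    exact Finset.sum_congr rfl fun y _ => by simp [mul_comm]

/-! ### Hurwitz-Radon orthogonal matrices -/

/-- Multiplication by `i` identifies the skew-adjoint with the self-adjoint matrices, and together
they make up the real space of all matrices, of dimension `2m²`. -/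
lemma finrank_skewAdjoint_matrix (m : ℕ) :
    Module.finrank ℝ (skewAdjoint.submodule ℝ (Matrix (Fin m) (Fin m) ℂ)) = m ^ 2 := by
  have h1 := (StarModule.decomposeProdAdjoint ℝ (Matrix (Fin m) (Fin m) ℂ)).finrank_eq
  have h2 : Module.finrank ℝ (selfAdjoint (Matrix (Fin m) (Fin m) ℂ))
      = Module.finrank ℝ (skewAdjoint (Matrix (Fin m) (Fin m) ℂ)) := by
    have hinj : Function.Injective (skewAdjoint.negISMul (A := Matrix (Fin m) (Fin m) ℂ)) := by
      intro a b hab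
      ext1
      rw [← skewAdjoint.I_smul_neg_I a, hab, skewAdjoint.I_smul_neg_I]
    have hsurj : Function.Surjective (skewAdjoint.negISMul (A := Matrix (Fin m) (Fin m) ℂ)) := by
      intro a
      refine ⟨⟨Complex.I • (a : Matrix (Fin m) (Fin m) ℂ), ?_⟩, ?_⟩
      · rw [skewAdjoint.mem_iff, star_smul, a.2.star_eq]; simp
      · ext1
        simp [smul_smul]
    exact (LinearEquiv.ofBijective _ ⟨hinj, hsurj⟩).finrank_eq.symm
  have : FiniteDimensional ℝ (selfAdjoint (Matrix (Fin m) (Fin m) ℂ)) :=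
    inferInstanceAs (FiniteDimensional ℝ (selfAdjoint.submodule ℝ (Matrix (Fin m) (Fin m) ℂ)))
  have : FiniteDimensional ℝ (skewAdjoint (Matrix (Fin m) (Fin m) ℂ)) :=
    inferInstanceAs (FiniteDimensional ℝ (skewAdjoint.submodule ℝ (Matrix (Fin m) (Fin m) ℂ)))
  rw [Module.finrank_prod, h2, Module.finrank_matrix, Complex.finrank_real_complex,
    Fintype.card_fin] at h1
  change Module.finrank ℝ (skewAdjoint (Matrix (Fin m) (Fin m) ℂ)) = _
  nlinarith

/-- The real space of the matrices that are Hurwitz-Radon orthogonal to `F`. -/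
def hrSpace {t N : ℕ} (F : Matrix (Fin t) (Fin N) ℂ) : Submodule ℝ (Matrix (Fin t) (Fin N) ℂ) where
  carrier := {V | Fᴴ * V + Vᴴ * F = 0}
  add_mem' {V W} hV hW := by
    have : Fᴴ * (V + W) + (V + W)ᴴ * F = (Fᴴ * V + Vᴴ * F) + (Fᴴ * W + Wᴴ * F) := by
      rw [conjTranspose_add, Matrix.mul_add, Matrix.add_mul]; abel
    rw [Set.mem_ofPred_eq, this, hV, hW, add_zero]
  zero_mem' := by simp
  smul_mem' c V hV := by
    have : Fᴴ * (c • V) + (c • V)ᴴ * F = c • (Fᴴ * V + Vᴴ * F) := by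
      simp [conjTranspose_smul]
    rw [Set.mem_ofPred_eq, this, hV, smul_zero]

lemma mem_hrSpace {t N : ℕ} {F V : Matrix (Fin t) (Fin N) ℂ} :
    V ∈ hrSpace F ↔ Fᴴ * V + Vᴴ * F = 0 := Iff.rfl

/-- The weight matrices that a channel matrix `H` annihilates. -/
noncomputable def annihilator (τ : Type*) {N M : ℕ} (H : Matrix (Fin N) (Fin M) ℂ) :
    Submodule ℝ (Matrix τ (Fin N) ℂ) :=
  LinearMap.ker (mulRightLinearMap τ ℝ H)

lemma mem_annihilator {τ : Type*} {N M : ℕ} {H : Matrix (Fin N) (Fin M) ℂ}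
    {V : Matrix τ (Fin N) ℂ} : V ∈ annihilator τ H ↔ V * H = 0 := Iff.rfl

lemma mulVec_injective_of_semiunitary {t N : ℕ} {F : Matrix (Fin t) (Fin N) ℂ}
    (hF : Fᴴ * F = 1) : Function.Injective F.mulVec := by
  intro v w h
  have := congrArg (fun x => Fᴴ *ᵥ x) h
  simpa [hF] using this

/-- Split the column space into the range of `F` and its orthogonal complement, the range of `E`.
The members of `p` are exactly `(F P S + E Z) Pᴴ` with `S` skew-Hermitian and `Z` arbitrary. The
projection `P Pᴴ` is left general so that `P = 1` gives `hrSpace F` itself, and a basis of the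
kernel of `Hᴴ` gives the part annihilated by `H`. -/
lemma finrank_of_mem_iff_hrSpace {t N m : ℕ} (F : Matrix (Fin t) (Fin N) ℂ) (hF : Fᴴ * F = 1)
    (P : Matrix (Fin N) (Fin m) ℂ) (hP : Pᴴ * P = 1) (p : Submodule ℝ (Matrix (Fin t) (Fin N) ℂ))
    (hp : ∀ V, V ∈ p ↔ V * P * Pᴴ = V ∧ V ∈ hrSpace F) :
    Module.finrank ℝ p = m ^ 2 + 2 * (t - N) * m := by
  obtain ⟨E, hE, hFE, hEc⟩ := exists_orthonormal_complement F (mulVec_injective_of_semiunitary hF)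
  have hEF : Eᴴ * F = 0 := by
    have := congrArg conjTranspose hFE
    simpa using this
  have hdec : ∀ V : Matrix (Fin t) (Fin N) ℂ, F * (Fᴴ * V) + E * (Eᴴ * V) = V := by
    intro V
    have h := hEc N (V - F * (Fᴴ * V)) (by
      rw [Matrix.mul_sub, ← Matrix.mul_assoc Fᴴ F, hF, Matrix.one_mul, sub_self])
    rw [Matrix.mul_sub, ← Matrix.mul_assoc Eᴴ F, hEF, Matrix.zero_mul, sub_zero] at h
    rw [h]; abel
  let Φ : (skewAdjoint.submodule ℝ (Matrix (Fin m) (Fin m) ℂ) × Matrix (Fin (t - N)) (Fin m) ℂ)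
      →ₗ[ℝ] Matrix (Fin t) (Fin N) ℂ :=
    { toFun := fun x => (F * (P * (x.1 : Matrix (Fin m) (Fin m) ℂ)) + E * x.2) * Pᴴ
      map_add' := fun x y => by
        simp only [Prod.fst_add, Prod.snd_add, Submodule.coe_add, Matrix.mul_add, Matrix.add_mul]
        abel
      map_smul' := fun c x => by simp [← smul_add] }
  have hΦ : ∀ x, Φ x = (F * (P * (x.1 : Matrix (Fin m) (Fin m) ℂ)) + E * x.2) * Pᴴ := fun _ => rfl
  have hinj : Function.Injective Φ := by
    rw [← LinearMap.ker_eq_bot, LinearMap.ker_eq_bot']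
    rintro ⟨S, Z⟩ h
    rw [hΦ] at h
    have h1 : F * (P * (S : Matrix (Fin m) (Fin m) ℂ)) + E * Z = 0 := by
      have := congrArg (· * P) h
      simpa [Matrix.mul_assoc, hP] using this
    have h2 : (S : Matrix (Fin m) (Fin m) ℂ) = 0 := by
      have := congrArg (fun X => Pᴴ * (Fᴴ * X)) h1
      simp only [Matrix.mul_add, ← Matrix.mul_assoc Fᴴ, hF, hFE] at this
      simpa [← Matrix.mul_assoc Pᴴ, hP] using this
    have h3 : Z = 0 := by
      have := congrArg (fun X => Eᴴ * X) h1
      simp only [Matrix.mul_add, ← Matrix.mul_assoc Eᴴ, hE, hEF] at this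
      simpa using this
    exact Prod.ext (Subtype.ext h2) h3
  have hrange : LinearMap.range Φ = p := by
    ext V
    rw [hp, LinearMap.mem_range]
    constructor
    · rintro ⟨⟨S, Z⟩, rfl⟩
      rw [hΦ]
      constructor
      · rw [Matrix.mul_assoc _ Pᴴ P, hP, Matrix.mul_one]
      · have hS : (S : Matrix (Fin m) (Fin m) ℂ)ᴴ = -S := S.2
        have h1 : Fᴴ * ((F * (P * (S : Matrix (Fin m) (Fin m) ℂ)) + E * Z) * Pᴴ)
            = P * (S : Matrix (Fin m) (Fin m) ℂ) * Pᴴ := by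
          rw [← Matrix.mul_assoc, Matrix.mul_add, ← Matrix.mul_assoc Fᴴ, hF, ← Matrix.mul_assoc Fᴴ,
            hFE, Matrix.one_mul, Matrix.zero_mul, add_zero]
        rw [mem_hrSpace]
        have h2 := congrArg conjTranspose h1
        rw [conjTranspose_mul, conjTranspose_conjTranspose] at h2
        rw [h1, h2]
        simp [conjTranspose_mul, hS, Matrix.mul_assoc]
    · rintro ⟨h1, h2⟩
      rw [mem_hrSpace] at h2
      have h3 : Fᴴ * V = -(Vᴴ * F) := eq_neg_of_add_eq_zero_left h2
      have h1' : P * (Pᴴ * Vᴴ) = Vᴴ := by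
        have := congrArg conjTranspose h1
        simpa [conjTranspose_mul] using this
      -- `Fᴴ V` is skew-Hermitian, so its invariance under `P Pᴴ` on the right passes to the left.
      have h4 : P * (Pᴴ * (Fᴴ * V)) = Fᴴ * V := by
        rw [h3, Matrix.mul_neg, Matrix.mul_neg, ← Matrix.mul_assoc Pᴴ, ← Matrix.mul_assoc P, h1']
      refine ⟨⟨⟨Pᴴ * (Fᴴ * V) * P, ?_⟩, Eᴴ * V * P⟩, ?_⟩
      · change (Pᴴ * (Fᴴ * V) * P)ᴴ = -(Pᴴ * (Fᴴ * V) * P)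
        conv_rhs => rw [h3]
        simp [conjTranspose_mul, Matrix.mul_assoc]
      · rw [hΦ]
        change (F * (P * (Pᴴ * (Fᴴ * V) * P)) + E * (Eᴴ * V * P)) * Pᴴ = V
        rw [← Matrix.mul_assoc P, h4, ← Matrix.mul_assoc F, ← Matrix.mul_assoc E,
          ← Matrix.add_mul, hdec, h1]
  rw [← hrange, LinearMap.finrank_range_of_inj hinj, Module.finrank_prod,
    finrank_skewAdjoint_matrix, Module.finrank_matrix, Complex.finrank_real_complex]
  simp only [Fintype.card_fin]
  ring

lemma finrank_hrSpace {t N : ℕ} {F : Matrix (Fin t) (Fin N) ℂ} (hF : Fᴴ * F = 1) :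
    Module.finrank ℝ (hrSpace F) = N ^ 2 + 2 * (t - N) * N :=
  finrank_of_mem_iff_hrSpace F hF 1 (by simp) _ (by simp)

lemma finrank_hrSpace_inf_annihilator {t N M : ℕ} {F : Matrix (Fin t) (Fin N) ℂ} (hF : Fᴴ * F = 1)
    {H : Matrix (Fin N) (Fin M) ℂ} (hH : Function.Injective H.mulVec) :
    Module.finrank ℝ (hrSpace F ⊓ annihilator (Fin t) H : Submodule ℝ _)
      = (N - M) ^ 2 + 2 * (t - N) * (N - M) := by
  obtain ⟨P, hP, hHP, hPc⟩ := exists_orthonormal_complement H hH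
  refine finrank_of_mem_iff_hrSpace F hF P hP _ fun V => ?_
  rw [Submodule.mem_inf, and_comm]
  refine and_congr_left fun _ => ?_
  rw [mem_annihilator]
  constructor
  · intro h
    have h1 : Hᴴ * Vᴴ = 0 := by rw [← conjTranspose_mul, h, conjTranspose_zero]
    have := congrArg conjTranspose (hPc _ _ h1)
    simpa [conjTranspose_mul] using this
  · intro h
    have hPH : Pᴴ * H = 0 := by
      have := congrArg conjTranspose hHP
      simpa using this
    rw [← h, Matrix.mul_assoc, hPH, Matrix.mul_zero]

end STBC

namespace STBC

open Matrix

/-! ### The equivalent channel -/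

/-- `vecTilde` as a real linear map. -/
def vecTildeLin (m n : Type*) : Matrix m n ℂ →ₗ[ℝ] ((n × m) ⊕ (n × m) → ℝ) where
  toFun := vecTilde
  map_add' X Y := by ext (p | p) <;> simp [vecTilde, Matrix.vec]
  map_smul' c X := by ext (p | p) <;> simp [vecTilde, Matrix.vec]

lemma vecTildeLin_apply {m n : Type*} (X : Matrix m n ℂ) : vecTildeLin m n X = vecTilde X := rfl

lemma vecTildeLin_injective (m n : Type*) : Function.Injective (vecTildeLin m n) := by
  intro X Y h
  ext i j
  have h1 := congrFun h (Sum.inl (j, i))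
  have h2 := congrFun h (Sum.inr (j, i))
  exact Complex.ext h1 h2

variable {τ ι : Type*} {N M : ℕ}

lemma equivChannel_mulVec [Fintype ι] (A : ι → Matrix τ (Fin N) ℂ) (H : Matrix (Fin N) (Fin M) ℂ)
    (x : ι → ℝ) : equivChannel A H *ᵥ x = vecTilde ((∑ k, x k • A k) * H) := by
  rw [Matrix.sum_mul, ← vecTildeLin_apply, map_sum]
  ext p
  simp [mulVec, dotProduct, equivChannel, vecTildeLin_apply, Finset.sum_apply, mul_comm]

/-- Rank-nullity: since `A` is independent and `vecTilde` is injective, forming linear combinations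
carries the kernel of the channel matrix isomorphically onto the annihilated part of the span. -/
lemma rank_equivChannel_add [Fintype τ] [Fintype ι] {A : ι → Matrix τ (Fin N) ℂ}
    (hA : LinearIndependent ℝ A) (H : Matrix (Fin N) (Fin M) ℂ) :
    (equivChannel A H).rank
      + Module.finrank ℝ (Submodule.span ℝ (Set.range A) ⊓ annihilator τ H : Submodule ℝ _)
      = Fintype.card ι := by
  have h1 := LinearMap.finrank_range_add_finrank_ker (equivChannel A H).mulVecLin
  rw [Module.finrank_fintype_fun_eq_card] at h1
  rw [← h1, Matrix.rank]
  congr 1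
  have hinj : Function.Injective (Fintype.linearCombination ℝ A) :=
    hA.fintypeLinearCombination_injective
  rw [(Submodule.equivMapOfInjective _ hinj (LinearMap.ker (equivChannel A H).mulVecLin)).finrank_eq]
  suffices hs : Submodule.span ℝ (Set.range A) ⊓ annihilator τ H = Submodule.map
      (Fintype.linearCombination ℝ A) (LinearMap.ker (equivChannel A H).mulVecLin) by rw [hs]
  have hker : ∀ x, x ∈ LinearMap.ker (equivChannel A H).mulVecLin ↔
      Fintype.linearCombination ℝ A x ∈ annihilator τ H := by
    intro x
    rw [LinearMap.mem_ker, mulVecLin_apply, equivChannel_mulVec, mem_annihilator,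
      Fintype.linearCombination_apply, ← vecTildeLin_apply,
      map_eq_zero_iff _ (vecTildeLin_injective _ _)]
  ext X
  rw [Submodule.mem_inf, ← Fintype.range_linearCombination, Submodule.mem_map]
  constructor
  · rintro ⟨⟨x, rfl⟩, hX⟩
    exact ⟨x, (hker x).2 hX, rfl⟩
  · rintro ⟨x, hx, rfl⟩
    exact ⟨⟨x, rfl⟩, (hker x).1 hx⟩

/-! ### The span of a group of weight matrices -/

lemma half_mul {m : Type*} (k : Fin 2) (X : Matrix (m ⊕ m) (Fin N) ℂ)
    (H : Matrix (Fin N) (Fin M) ℂ) : half k (X * H) = half k X * H := by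
  fin_cases k <;> rfl

/-- Half `k` and the other half of a matrix. -/
def halvesEquiv (m n : Type*) (k : Fin 2) :
    Matrix (m ⊕ m) n ℂ ≃ₗ[ℝ] Matrix m n ℂ × Matrix m n ℂ where
  toFun X := (half k X, half (k + 1) X)
  invFun p := Matrix.fromRows (![p.1, p.2] k) (![p.2, p.1] k)
  map_add' X Y := by fin_cases k <;> rfl
  map_smul' c X := by fin_cases k <;> rfl
  left_inv X := by fin_cases k <;> simp [half]
  right_inv p := by fin_cases k <;> simp [half]

lemma halvesEquiv_apply {m n : Type*} (k : Fin 2) (X : Matrix (m ⊕ m) n ℂ) :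
    halvesEquiv m n k X = (half k X, half (k + 1) X) := rfl

lemma eq_zero_iff_half {m n : Type*} (k : Fin 2) (X : Matrix (m ⊕ m) n ℂ) :
    X = 0 ↔ half k X = 0 ∧ half (k + 1) X = 0 := by
  rw [← (halvesEquiv m n k).map_eq_zero_iff, halvesEquiv_apply, Prod.mk_eq_zero]

lemma mem_annihilator_iff_half {m : Type*} (k : Fin 2) {X : Matrix (m ⊕ m) (Fin N) ℂ}
    {H : Matrix (Fin N) (Fin M) ℂ} :
    X ∈ annihilator (m ⊕ m) H ↔
      half k X ∈ annihilator m H ∧ half (k + 1) X ∈ annihilator m H := by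
  simp only [mem_annihilator]
  rw [eq_zero_iff_half k, half_mul, half_mul]

lemma mem_map_linearEquiv {V W : Type*} [AddCommGroup V] [Module ℝ V] [AddCommGroup W]
    [Module ℝ W] (e : V ≃ₗ[ℝ] W) (p : Submodule ℝ V) (x : V) :
    e x ∈ p.map e.toLinearMap ↔ x ∈ p :=
  e.injective.mem_set_image

lemma finrank_submodule_prod {V W : Type*} [AddCommGroup V] [Module ℝ V] [AddCommGroup W]
    [Module ℝ W] [FiniteDimensional ℝ V] [FiniteDimensional ℝ W] (p : Submodule ℝ V)
    (q : Submodule ℝ W) :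
    Module.finrank ℝ (p.prod q) = Module.finrank ℝ p + Module.finrank ℝ q := by
  have h : LinearMap.range (p.subtype.prodMap q.subtype) = p.prod q := by
    rw [LinearMap.range_prodMap, Submodule.range_subtype, Submodule.range_subtype]
  rw [← h, LinearMap.finrank_range_of_inj, Module.finrank_prod]
  rw [LinearMap.coe_prodMap]
  exact p.injective_subtype.prodMap q.injective_subtype

lemma card_arith {N T : ℕ} (hT : Even T) (hNT : 2 * N ≤ T) :
    T * N - N ^ 2 = N ^ 2 + 2 * (T / 2 - N) * N := by
  obtain ⟨t, rfl⟩ := hT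
  obtain ⟨s, rfl⟩ : ∃ s, t = N + s := ⟨t - N, by omega⟩
  have h1 : (N + s + (N + s)) / 2 - N = s := by omega
  rw [h1]
  have : (N + s + (N + s)) * N = (N ^ 2 + 2 * s * N) + N ^ 2 := by ring
  omega

namespace IsTwoGroupCode

variable {T : ℕ} {F : Fin 2 → Matrix (Fin (T / 2)) (Fin N) ℂ}
  {A : Fin 2 × Fin (T * N - N ^ 2 + 1) → Matrix (Fin (T / 2) ⊕ Fin (T / 2)) (Fin N) ℂ}

lemma linearIndependent_group (h : IsTwoGroupCode F A) (g : Fin 2) :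
    LinearIndependent ℝ fun j => A (g, j) :=
  h.linearIndependent.comp (fun j => (g, j)) fun _ _ h => (Prod.mk.inj h).2

/-- In `Fin 2`, `g + 1` is the other group. Any of its matrices has `±F (g + 1)` as half `g + 1`,
and Hurwitz-Radon orthogonality ignores the sign. -/
lemma half_add_one_mem_hrSpace (h : IsTwoGroupCode F A) (g : Fin 2) (j) :
    half (g + 1) (A (g, j)) ∈ hrSpace (F (g + 1)) := by
  have key : ∀ V W : Matrix (Fin (T / 2)) (Fin N) ℂ,
      (V = F (g + 1) ∨ V = -F (g + 1)) → Vᴴ * W + Wᴴ * V = 0 → W ∈ hrSpace (F (g + 1)) := by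
    rintro V W (rfl | rfl) hV
    · exact hV
    · rw [mem_hrSpace]
      rw [conjTranspose_neg, Matrix.neg_mul, Matrix.mul_neg] at hV
      rw [← neg_eq_zero, neg_add]
      exact hV
  refine key _ _ (h.half_eq (g + 1) 0) ?_
  fin_cases g
  · have := h.orthogonal 1 j 0
    rw [add_comm]
    exact this
  · exact h.orthogonal 0 0 j

/-- One inclusion is immediate on generators; the group size `TN - N² + 1` equals the dimension of
the product, so it is an equality. -/
lemma map_span_group (hN : 1 ≤ N) (hT : Even T) (hNT : 2 * N ≤ T) (h : IsTwoGroupCode F A)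
    (g : Fin 2) :
    (Submodule.span ℝ (Set.range fun j => A (g, j))).map
        (halvesEquiv (Fin (T / 2)) (Fin N) g).toLinearMap
      = (Submodule.span ℝ {F g}).prod (hrSpace (F (g + 1))) := by
  apply Submodule.eq_of_le_of_finrank_eq
  · rw [Submodule.map_span, Submodule.span_le]
    rintro _ ⟨_, ⟨j, rfl⟩, rfl⟩
    refine ⟨?_, h.half_add_one_mem_hrSpace g j⟩
    have hF : F g ∈ Submodule.span ℝ {F g} := Submodule.mem_span_singleton_self _
    rcases h.half_eq g j with h1 | h1
    · exact h1 ▸ hF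
    · change half g (A (g, j)) ∈ _
      exact h1 ▸ Submodule.neg_mem _ hF
  · have hF : F g ≠ 0 := by
      intro h0
      have := h.semiunitary g
      rw [h0] at this
      have := congrFun (congrFun this ⟨0, hN⟩) ⟨0, hN⟩
      simp at this
    rw [LinearEquiv.finrank_map_eq, finrank_submodule_prod, finrank_span_singleton hF,
      finrank_hrSpace (h.semiunitary _), finrank_span_eq_card (h.linearIndependent_group g),
      Fintype.card_fin, card_arith hT hNT, add_comm]

/-- Half `g` of an annihilated matrix is a multiple of `F g`, and `F g * H ≠ 0` forces the multiple
to vanish. What remains is the other half, a Hurwitz-Radon orthogonal matrix killed by `H`. -/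
lemma finrank_span_group_inf_annihilator (hN : 1 ≤ N) (hT : Even T) (hNT : 2 * N ≤ T)
    (h : IsTwoGroupCode F A) (g : Fin 2) {H : Matrix (Fin N) (Fin M) ℂ} (hM : 1 ≤ M)
    (hH : Function.Injective H.mulVec) :
    Module.finrank ℝ (Submodule.span ℝ (Set.range fun j => A (g, j))
      ⊓ annihilator (Fin (T / 2) ⊕ Fin (T / 2)) H : Submodule ℝ _)
      = (N - M) ^ 2 + 2 * (T / 2 - N) * (N - M) := by
  have hFH : F g * H ≠ 0 := by
    intro h0
    have h1 := congrArg (fun X => (F g)ᴴ * X) h0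
    simp only [← Matrix.mul_assoc, h.semiunitary, Matrix.one_mul, Matrix.mul_zero] at h1
    have h2 : (Pi.single ⟨0, hM⟩ 1 : Fin M → ℂ) = 0 := hH (by simp only [h1, Matrix.zero_mulVec])
    have := congrFun h2 ⟨0, hM⟩
    simp at this
  rw [← finrank_hrSpace_inf_annihilator (h.semiunitary (g + 1)) hH]
  rw [← LinearEquiv.finrank_map_eq (halvesEquiv (Fin (T / 2)) (Fin N) g)]
  have : (Submodule.span ℝ (Set.range fun j => A (g, j))
      ⊓ annihilator (Fin (T / 2) ⊕ Fin (T / 2)) H).map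
        (halvesEquiv (Fin (T / 2)) (Fin N) g).toLinearMap
      = (⊥ : Submodule ℝ _).prod (hrSpace (F (g + 1)) ⊓ annihilator (Fin (T / 2)) H) := by
    have hmem : ∀ X, X ∈ Submodule.span ℝ (Set.range fun j => A (g, j)) ↔
        half g X ∈ Submodule.span ℝ {F g} ∧ half (g + 1) X ∈ hrSpace (F (g + 1)) := by
      intro X
      have h1 : halvesEquiv (Fin (T / 2)) (Fin N) g X ∈
          (Submodule.span ℝ {F g}).prod (hrSpace (F (g + 1))) ↔ _ := Submodule.mem_prod
      rw [← map_span_group hN hT hNT h] at h1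
      rw [mem_map_linearEquiv] at h1
      exact h1
    ext p
    obtain ⟨X, rfl⟩ := (halvesEquiv (Fin (T / 2)) (Fin N) g).surjective p
    rw [mem_map_linearEquiv, Submodule.mem_inf, hmem, mem_annihilator_iff_half g,
      halvesEquiv_apply, Submodule.mem_prod, Submodule.mem_inf, Submodule.mem_bot]
    constructor
    · rintro ⟨⟨h1, h2⟩, h3, h4⟩
      refine ⟨?_, h2, h4⟩
      obtain ⟨c, hc⟩ := Submodule.mem_span_singleton.mp h1
      rw [mem_annihilator, ← hc, Matrix.smul_mul, smul_eq_zero] at h3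
      rw [← hc]
      dsimp only
      rw [h3.resolve_right hFH, zero_smul]
    · rintro ⟨h1, h2, h4⟩
      dsimp only at h1
      rw [h1]
      exact ⟨⟨Submodule.zero_mem _, h2⟩, Submodule.zero_mem _, h4⟩
  rw [this, finrank_submodule_prod, finrank_bot, zero_add]

lemma rank_groupChannel (hN : 1 ≤ N) (hT : Even T) (hNT : 2 * N ≤ T)
    (h : IsTwoGroupCode F A) (g : Fin 2) {H : Matrix (Fin N) (Fin M) ℂ} (hM : 1 ≤ M)
    (hH : Function.Injective H.mulVec) :
    (groupChannel A H g).rank + ((N - M) ^ 2 + 2 * (T / 2 - N) * (N - M))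
      = T * N - N ^ 2 + 1 := by
  have h1 := rank_equivChannel_add (h.linearIndependent_group g) H
  rw [h.finrank_span_group_inf_annihilator hN hT hNT g hM hH, Fintype.card_fin] at h1
  exact h1

end IsTwoGroupCode

/-! ### Rank of the whole equivalent channel -/

lemma annihilator_eq_bot {H : Matrix (Fin N) (Fin M) ℂ}
    (hH : Function.Injective H.vecMul) : annihilator τ H = ⊥ := by
  refine (Submodule.eq_bot_iff _).2 fun V hV => ?_
  rw [mem_annihilator] at hV
  ext i j
  have h : V.row i ᵥ* H = 0 ᵥ* H := by
    rw [Matrix.zero_vecMul]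
    ext k
    exact congrFun (congrFun hV i) k
  exact congrFun (hH h) j

lemma rank_equivChannel_eq_card [Fintype τ] [Fintype ι] {A : ι → Matrix τ (Fin N) ℂ}
    (hA : LinearIndependent ℝ A) {H : Matrix (Fin N) (Fin M) ℂ}
    (hH : Function.Injective H.vecMul) : (equivChannel A H).rank = Fintype.card ι := by
  rw [← rank_equivChannel_add hA H, annihilator_eq_bot hH, inf_bot_eq, finrank_bot, add_zero]

/-- Group 0 alone already contributes a kernel of dimension at least `(N - M)² > 0`. -/
lemma IsTwoGroupCode.rank_equivChannel_lt (hN : 1 ≤ N) {T : ℕ} (hT : Even T) (hNT : 2 * N ≤ T)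
    {F : Fin 2 → Matrix (Fin (T / 2)) (Fin N) ℂ}
    {A : Fin 2 × Fin (T * N - N ^ 2 + 1) → Matrix (Fin (T / 2) ⊕ Fin (T / 2)) (Fin N) ℂ}
    (h : IsTwoGroupCode F A) {H : Matrix (Fin N) (Fin M) ℂ} (hM : 1 ≤ M) (hMN : M < N)
    (hH : Function.Injective H.mulVec) :
    (equivChannel A H).rank < Fintype.card (Fin 2 × Fin (T * N - N ^ 2 + 1)) := by
  have h1 := rank_equivChannel_add h.linearIndependent H
  have h2 := h.finrank_span_group_inf_annihilator hN hT hNT 0 hM hH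
  have h3 : Submodule.span ℝ (Set.range fun j => A (0, j))
      ⊓ annihilator (Fin (T / 2) ⊕ Fin (T / 2)) H
      ≤ Submodule.span ℝ (Set.range A) ⊓ annihilator (Fin (T / 2) ⊕ Fin (T / 2)) H :=
    inf_le_inf_right _ (Submodule.span_mono (by rintro _ ⟨j, rfl⟩; exact ⟨_, rfl⟩))
  have h4 := Submodule.finrank_mono h3
  have h5 : 0 < (N - M) ^ 2 := by have : 0 < N - M := by omega
                                  positivity
  omega

/-! ### Existence of codes -/

lemma exists_isTwoGroupCode {T : ℕ} (hN : 1 ≤ N) (hT : Even T) (hNT : 2 * N ≤ T) :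
    ∃ (F : Fin 2 → Matrix (Fin (T / 2)) (Fin N) ℂ)
      (A : Fin 2 × Fin (T * N - N ^ 2 + 1) → Matrix (Fin (T / 2) ⊕ Fin (T / 2)) (Fin N) ℂ),
      IsTwoGroupCode F A := by
  have hle : N ≤ T / 2 := by omega
  let F : Matrix (Fin (T / 2)) (Fin N) ℂ :=
    (1 : Matrix (Fin (T / 2)) (Fin (T / 2)) ℂ).submatrix id (Fin.castLE hle)
  have hF : Fᴴ * F = 1 := by
    rw [conjTranspose_submatrix, conjTranspose_one,
      ← submatrix_mul (1 : Matrix (Fin (T / 2)) (Fin (T / 2)) ℂ) 1 (Fin.castLE hle) id (Fin.castLE hle)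
        Function.bijective_id, Matrix.one_mul,
      submatrix_one _ (Fin.castLE_injective hle)]
  let b := Module.finBasisOfFinrankEq ℝ (hrSpace F)
    ((finrank_hrSpace hF).trans (card_arith hT hNT).symm)
  -- A basis of `hrSpace F` is one vector short. The added `0` makes the family affinely
  -- independent, and the constant half `F` detects the sum of the coefficients.
  let w : Fin (T * N - N ^ 2 + 1) → Matrix (Fin (T / 2)) (Fin N) ℂ :=
    Fin.cons 0 fun j => (b j : Matrix (Fin (T / 2)) (Fin N) ℂ)
  have hw : ∀ j, w j ∈ hrSpace F := by
    intro j
    refine Fin.cases ?_ (fun j => ?_) j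
    · exact Submodule.zero_mem _
    · exact (b j).2
  have hwc : ∀ c : Fin (T * N - N ^ 2 + 1) → ℝ, ∑ j, c j = 0 → ∑ j, c j • w j = 0 →
      ∀ j, c j = 0 := by
    intro c h1 h2
    rw [Fin.sum_univ_succ] at h1 h2
    have h3 : ∀ j : Fin (T * N - N ^ 2), c j.succ = 0 := by
      refine Fintype.linearIndependent_iff.mp b.linearIndependent _ ?_
      ext1
      simpa [w] using h2
    intro j
    refine Fin.cases ?_ h3 j
    simpa [h3] using h1
  have hFw : ∀ (a : ℝ) (c : Fin (T * N - N ^ 2 + 1) → ℝ), a • F + ∑ j, c j • w j = 0 →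
      a = 0 ∧ ∑ j, c j • w j = 0 := by
    intro a c h
    have hm : ∑ j, c j • w j ∈ hrSpace F :=
      Submodule.sum_mem _ fun j _ => Submodule.smul_mem _ _ (hw j)
    -- `F` itself is not in `hrSpace F`, because `Fᴴ F + Fᴴ F = 2`.
    have ha : a = 0 := by
      rw [← eq_neg_iff_add_eq_zero] at h
      have h1 : a • F ∈ hrSpace F := h ▸ Submodule.neg_mem _ hm
      rw [mem_hrSpace, conjTranspose_smul, Matrix.mul_smul, Matrix.smul_mul, hF] at h1
      have h2 := congrFun (congrFun h1 ⟨0, hN⟩) ⟨0, hN⟩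
      have h3 := congrArg Complex.re h2
      simp at h3
      linarith
    rw [ha, zero_smul, zero_add] at h
    exact ⟨ha, h⟩
  let A : Fin 2 × Fin (T * N - N ^ 2 + 1) → Matrix (Fin (T / 2) ⊕ Fin (T / 2)) (Fin N) ℂ :=
    fun p => ![fromRows F (w p.2), fromRows (w p.2) F] p.1
  have h00 : ∀ j, half 0 (A (0, j)) = F := fun _ => rfl
  have h01 : ∀ j, half 0 (A (1, j)) = w j := fun _ => rfl
  have h10 : ∀ j, half 1 (A (0, j)) = w j := fun _ => rfl
  have h11 : ∀ j, half 1 (A (1, j)) = F := fun _ => rfl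
  refine ⟨fun _ => F, A, ?_, fun _ => hF, ?_, ?_⟩
  · rw [Fintype.linearIndependent_iff]
    intro c hc
    rw [Fintype.sum_prod_type, Fin.sum_univ_two] at hc
    have e := congrArg (halvesEquiv (Fin (T / 2)) (Fin N) 0) hc
    simp only [map_add, map_sum, map_smul, halvesEquiv_apply, zero_add, h00, h01, h10, h11,
      map_zero] at e
    have e1 := congrArg Prod.fst e
    have e2 := congrArg Prod.snd e
    simp only [Prod.fst_add, Prod.fst_sum, Prod.smul_fst, Prod.fst_zero, Prod.snd_add,
      Prod.snd_sum, Prod.smul_snd, Prod.snd_zero, ← Finset.sum_smul] at e1 e2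
    rw [add_comm] at e2
    -- Each half couples the coefficient sum of one group with the `w`-combination of the other;
    -- both must vanish, and the two halves together supply both relations for each group.
    obtain ⟨s1, s2⟩ := hFw _ _ e1
    obtain ⟨s3, s4⟩ := hFw _ _ e2
    rintro ⟨g, j⟩
    fin_cases g
    · exact hwc _ s1 s4 j
    · exact hwc _ s3 s2 j
  · intro k j
    left
    fin_cases k
    · exact h00 j
    · exact h11 j
  · intro k i j
    fin_cases k
    · exact hw j
    · rw [add_comm]; exact hw i

end STBC

namespace STBC

open Matrix

/-! ### Product measures and one coordinate -/

/-- Replacing one coordinate by an independent copy does not change the law. On boxes, the discarded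
coordinate contributes the total mass 1. -/
lemma measurePreserving_update {ι : Type*} [Fintype ι] [DecidableEq ι] {α : ι → Type*}
    [∀ i, MeasurableSpace (α i)] (μ : ∀ i, Measure (α i)) [∀ i, IsProbabilityMeasure (μ i)]
    (i : ι) :
    MeasurePreserving (fun p : (∀ i, α i) × α i => Function.update p.1 i p.2)
      ((Measure.pi μ).prod (μ i)) (Measure.pi μ) := by
  have hmeas : Measurable (fun p : (∀ i, α i) × α i => Function.update p.1 i p.2) := by
    refine measurable_pi_lambda _ fun j => ?_
    by_cases hj : j = i
    · subst hj; simpa using measurable_snd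
    · simp only [Function.update_of_ne hj]
      exact (measurable_pi_apply j).comp measurable_fst
  refine ⟨hmeas, (Measure.pi_eq fun s hs => ?_).symm⟩
  rw [Measure.map_apply hmeas (MeasurableSet.univ_pi hs)]
  have hpre : (fun p : (∀ i, α i) × α i => Function.update p.1 i p.2) ⁻¹' Set.univ.pi s
      = (Set.univ.pi (Function.update s i Set.univ)) ×ˢ s i := by
    ext ⟨x, z⟩
    simp only [Set.mem_preimage, Set.mem_pi, Set.mem_univ, true_imp_iff, Set.mem_prod]
    constructor
    · intro h
      refine ⟨fun j => ?_, by simpa using h i⟩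
      by_cases hj : j = i
      · subst hj; simp
      · simpa [Function.update_of_ne hj] using h j
    · rintro ⟨h1, h2⟩ j
      by_cases hj : j = i
      · subst hj; simpa using h2
      · simpa [Function.update_of_ne hj] using h1 j
  rw [hpre, Measure.prod_prod, Measure.pi_pi, ← Finset.prod_erase_mul _ _ (Finset.mem_univ i),
    ← Finset.prod_erase_mul (s := Finset.univ) (fun j => μ j (s j)) (Finset.mem_univ i)]
  simp only [Function.update_self, measure_univ, mul_one]
  congr 1
  refine Finset.prod_congr rfl fun j hj => ?_
  rw [Function.update_of_ne (Finset.ne_of_mem_erase hj)]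

lemma ae_pi_of_ae_update {ι : Type*} [Fintype ι] [DecidableEq ι] {α : ι → Type*}
    [∀ i, MeasurableSpace (α i)] (μ : ∀ i, Measure (α i)) [∀ i, IsProbabilityMeasure (μ i)]
    (i : ι) {p : (∀ i, α i) → Prop} (hp : MeasurableSet {x | p x})
    (h : ∀ᵐ x ∂(Measure.pi μ), ∀ᵐ z ∂(μ i), p (Function.update x i z)) :
    ∀ᵐ x ∂(Measure.pi μ), p x := by
  have hmp := measurePreserving_update μ i
  rw [← hmp.map_eq, ae_map_iff hmp.measurable.aemeasurable hp]
  exact (Measure.ae_prod_iff_ae_ae (hmp.measurable hp)).2 h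

/-! ### Gaussian matrices -/

lemma measurable_complexMk : Measurable (fun p : ℝ × ℝ => (⟨p.1, p.2⟩ : ℂ)) :=
  Complex.measurableEquivRealProd.symm.measurable

instance : IsProbabilityMeasure complexGaussian :=
  Measure.isProbabilityMeasure_map measurable_complexMk.aemeasurable

instance : NullSingletonClass complexGaussian where
  measure_singleton c := by
    have : NullSingletonClass (gaussianReal 0 (1 / 2)) := nullSingletonClass_gaussianReal (by norm_num)
    rw [complexGaussian, Measure.map_apply measurable_complexMk (measurableSet_singleton c)]
    have h0 : ((gaussianReal 0 (1 / 2)).prod (gaussianReal 0 (1 / 2))) {(c.re, c.im)} = 0 := by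
      rw [← Set.singleton_prod_singleton, Measure.prod_prod, measure_singleton, zero_mul]
    refine measure_mono_null ?_ h0
    rintro ⟨a, b⟩ h
    have h' : (⟨a, b⟩ : ℂ) = c := h
    simp [← h']

instance {m n : Type*} [Fintype m] [Fintype n] : IsProbabilityMeasure (gaussianMatrix m n) :=
  inferInstanceAs (IsProbabilityMeasure (Measure.pi fun _ : m => Measure.pi fun _ : n => complexGaussian))

lemma measurable_entry {m n : Type*} (i : m) (j : n) :
    Measurable (fun H : Matrix m n ℂ => H i j) :=
  (measurable_pi_apply j).comp (measurable_pi_apply (X := fun _ : m => n → ℂ) i)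

lemma measurable_det_submatrix {m n k : Type*} [Fintype k] [DecidableEq k] (e : k → m) (f : k → n) :
    Measurable (fun H : Matrix m n ℂ => (H.submatrix e f).det) := by
  simp only [det_apply, submatrix_apply]
  refine Finset.measurable_fun_sum _ fun σ _ => ?_
  exact (Finset.measurable_fun_prod _ fun i _ => measurable_entry _ _).const_smul _

/-- Laplace expansion along the last row: the minor is affine in its corner entry, with the next
smaller leading minor as slope. -/
lemma exists_det_leading_updateRow {N M k : ℕ} (H : Matrix (Fin N) (Fin M) ℂ) (z : Fin M → ℂ)
    (hN : k + 1 ≤ N) (hM : k + 1 ≤ M) :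
    ∃ K : ℂ, ∀ c : ℂ,
      ((H.updateRow ⟨k, hN⟩ (Function.update z ⟨k, hM⟩ c)).submatrix
        (Fin.castLE hN) (Fin.castLE hM)).det
      = K + c * (H.submatrix (Fin.castLE (Nat.le_of_succ_le hN))
          (Fin.castLE (Nat.le_of_succ_le hM))).det := by
  refine ⟨∑ j : Fin k, (-1) ^ (k + (j : ℕ)) * z (Fin.castLE hM j.castSucc) *
    (H.submatrix (fun i : Fin k => Fin.castLE hN i.castSucc)
      (fun l => Fin.castLE hM (j.castSucc.succAbove l))).det, fun c => ?_⟩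
  have hsub : ∀ f : Fin k → Fin M,
      (H.updateRow ⟨k, hN⟩ (Function.update z ⟨k, hM⟩ c)).submatrix
        (fun i : Fin k => Fin.castLE hN i.castSucc) f
      = H.submatrix (fun i : Fin k => Fin.castLE hN i.castSucc) f := by
    intro f
    ext i l
    have : Fin.castLE hN i.castSucc ≠ ⟨k, hN⟩ := by
      intro h
      have := congrArg Fin.val h
      simp at this
      omega
    rw [submatrix_apply, submatrix_apply, updateRow_ne this]
  have ha : Fin.castLE hN (Fin.last k) = ⟨k, hN⟩ := rfl
  have hb : Fin.castLE hM (Fin.last k) = ⟨k, hM⟩ := rfl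
  rw [det_succ_row _ (Fin.last k), Fin.sum_univ_castSucc]
  congr 1
  · refine Finset.sum_congr rfl fun j _ => ?_
    have hj : Fin.castLE hM j.castSucc ≠ ⟨k, hM⟩ := by
      intro h
      have := congrArg Fin.val h
      simp at this
      omega
    rw [submatrix_apply, ha, updateRow_self, Function.update_of_ne hj, submatrix_submatrix,
      Fin.succAbove_last, Fin.val_last, Fin.val_castSucc, ← hsub]
    rfl
  · rw [submatrix_apply, ha, hb, updateRow_self, Function.update_self, submatrix_submatrix,
      Fin.succAbove_last, Even.neg_one_pow ⟨_, rfl⟩, one_mul]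
    exact congrArg (fun X : Matrix (Fin k) (Fin k) ℂ => c * X.det) (hsub _)

/-- By induction the slope is almost surely nonzero, so a single value of the corner entry makes the
minor vanish, and the Gaussian law has no atoms. The row and then the entry are resampled, following
the nested product measure. -/
lemma ae_det_leading_ne_zero {N M : ℕ} (k : ℕ) (hN : k ≤ N) (hM : k ≤ M) :
    ∀ᵐ H ∂(gaussianMatrix (Fin N) (Fin M)),
      (H.submatrix (Fin.castLE hN) (Fin.castLE hM)).det ≠ 0 := by
  induction k with
  | zero => simp
  | succ k ih =>
    specialize ih (by omega) (by omega)
    let a : Fin N := ⟨k, hN⟩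
    let b : Fin M := ⟨k, hM⟩
    have hset : MeasurableSet {H : Matrix (Fin N) (Fin M) ℂ |
        (H.submatrix (Fin.castLE hN) (Fin.castLE hM)).det ≠ 0} :=
      (measurable_det_submatrix (Fin.castLE hN) (Fin.castLE hM)
        (measurableSet_singleton (0 : ℂ))).compl
    refine ae_pi_of_ae_update (fun _ : Fin N => Measure.pi fun _ : Fin M => complexGaussian) a
      (p := fun H => (Matrix.submatrix (H : Matrix (Fin N) (Fin M) ℂ) (Fin.castLE hN)
        (Fin.castLE hM)).det ≠ 0)
      hset ?_
    have ih' : ∀ᵐ H : Fin N → Fin M → ℂ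
        ∂(Measure.pi fun _ : Fin N => Measure.pi fun _ : Fin M => complexGaussian),
      (Matrix.submatrix (H : Matrix (Fin N) (Fin M) ℂ) (Fin.castLE (by omega : k ≤ N))
        (Fin.castLE (by omega : k ≤ M))).det ≠ 0 := ih
    filter_upwards [ih'] with H hH
    refine ae_pi_of_ae_update (fun _ : Fin M => complexGaussian) b
      (p := fun z => (Matrix.submatrix (Function.update H a z : Matrix (Fin N) (Fin M) ℂ)
        (Fin.castLE hN) (Fin.castLE hM)).det ≠ 0)
      ((measurable_update H (a := a)) hset) ?_
    refine Filter.Eventually.of_forall fun z => ?_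
    obtain ⟨K, hK⟩ := exists_det_leading_updateRow H z hN hM
    have hne := (Set.finite_singleton
      (-K / (Matrix.submatrix (H : Matrix (Fin N) (Fin M) ℂ) (Fin.castLE (by omega : k ≤ N))
            (Fin.castLE (by omega : k ≤ M))).det)).countable.ae_notMem complexGaussian
    filter_upwards [hne] with c hc
    refine ne_of_eq_of_ne (hK c) ?_
    intro h0
    apply hc
    rw [Set.mem_singleton_iff, eq_div_iff hH]
    linear_combination h0

lemma ae_mulVec_injective {N M : ℕ} (h : M ≤ N) :
    ∀ᵐ H ∂(gaussianMatrix (Fin N) (Fin M)), Function.Injective H.mulVec := by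
  filter_upwards [ae_det_leading_ne_zero M h le_rfl] with H hH
  intro v w hvw
  refine mulVec_injective_of_isUnit ((isUnit_iff_isUnit_det _).2 (isUnit_iff_ne_zero.2 hH)) ?_
  ext i
  exact congrFun hvw (Fin.castLE h i)

lemma ae_vecMul_injective {N M : ℕ} (h : N ≤ M) :
    ∀ᵐ H ∂(gaussianMatrix (Fin N) (Fin M)), Function.Injective H.vecMul := by
  filter_upwards [ae_det_leading_ne_zero N le_rfl h] with H hH
  intro v w hvw
  refine vecMul_injective_of_isUnit ((isUnit_iff_isUnit_det _).2 (isUnit_iff_ne_zero.2 hH)) ?_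
  ext i
  exact congrFun hvw (Fin.castLE h i)

/-! ### Moments -/

lemma memLp_norm_complexGaussian (k : ℕ) : MemLp (fun c : ℂ => ‖c‖) k complexGaussian := by
  have h1 : MemLp (fun p : ℝ × ℝ => |p.1| + |p.2|) k
      ((gaussianReal 0 (1 / 2)).prod (gaussianReal 0 (1 / 2))) := by
    have h := (memLp_id_gaussianReal' (μ := 0) (v := 1 / 2) (k : ℝ≥0∞) (by simp)).norm
    exact (h.comp_measurePreserving measurePreserving_fst).add
      (h.comp_measurePreserving measurePreserving_snd)
  rw [complexGaussian, memLp_map_measure_iff (by fun_prop) measurable_complexMk.aemeasurable]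
  refine h1.mono' ((by fun_prop : Measurable fun c : ℂ => ‖c‖).comp
    measurable_complexMk).aestronglyMeasurable (Filter.Eventually.of_forall fun p => ?_)
  simpa using Complex.norm_le_abs_re_add_abs_im (⟨p.1, p.2⟩ : ℂ)

lemma measurePreserving_entry {m n : Type*} [Fintype m] [Fintype n] (i : m) (j : n) :
    MeasurePreserving (fun W : Matrix m n ℂ => W i j) (gaussianMatrix m n) complexGaussian :=
  (measurePreserving_eval (fun _ : n => complexGaussian) j).comp
    (measurePreserving_eval (fun _ : m => Measure.pi fun _ : n => complexGaussian) i)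

lemma lintegral_norm_pow_lt_top {m n : Type*} [Fintype m] [Fintype n] (k : ℕ) (hk : k ≠ 0) :
    ∫⁻ W, ENNReal.ofReal ((1 + ∑ i, ∑ j, ‖W i j‖) ^ k) ∂(gaussianMatrix m n) < ∞ := by
  have h1 : MemLp (fun W : Matrix m n ℂ => 1 + ∑ i, ∑ j, ‖W i j‖) k (gaussianMatrix m n) := by
    have h0 : ∀ i j, MemLp (fun W : Matrix m n ℂ => ‖W i j‖) k (gaussianMatrix m n) := fun i j =>
      (memLp_norm_complexGaussian k).comp_measurePreserving (measurePreserving_entry i j)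
    have h2 : MemLp (fun W : Matrix m n ℂ => ∑ i, ∑ j, ‖W i j‖) k (gaussianMatrix m n) :=
      memLp_finsetSum _ fun i _ => memLp_finsetSum _ fun j _ => h0 i j
    exact (memLp_const (1 : ℝ)).add h2
  have h2 := lintegral_rpow_enorm_lt_top_of_eLpNorm_lt_top (by simpa using hk) (by simp)
    h1.eLpNorm_lt_top
  refine lt_of_eq_of_lt (lintegral_congr fun W => ?_) h2
  have hnn : 0 ≤ 1 + ∑ i, ∑ j, ‖W i j‖ := by positivity
  rw [ENNReal.toReal_natCast, ENNReal.rpow_natCast, ENNReal.ofReal_pow hnn, Real.enorm_of_nonneg hnn]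

end STBC

namespace STBC

open Matrix

/-! ### The constellation -/

lemma pam_nonempty {q : ℕ} (hq : 1 ≤ q) : (pam q).Nonempty :=
  Finset.Nonempty.image ⟨0, Finset.mem_range.2 hq⟩ _

lemma card_pam_le (q : ℕ) : (pam q).card ≤ q :=
  Finset.card_image_le.trans_eq (Finset.card_range q)

lemma card_signalSet_le (c q : ℕ) : (signalSet (Fin c) q).card ≤ q ^ c := by
  rw [signalSet, Fintype.card_piFinset_const]
  exact Nat.pow_le_pow_left (card_pam_le q) c

lemma mem_signalSet {ι : Type*} [Fintype ι] [DecidableEq ι] {q : ℕ} {s : ι → ℤ} :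
    s ∈ signalSet ι q ↔ ∀ i, s i ∈ pam q := Fintype.mem_piFinset

lemma mem_pamInterval {q : ℕ} {lo hi : ℝ} {a : ℤ} :
    a ∈ pamInterval q lo hi ↔ a ∈ pam q ∧ lo ≤ a ∧ (a : ℝ) ≤ hi := by
  simp only [pamInterval, pam, Finset.mem_image, Finset.mem_Icc, Finset.mem_range, max_le_iff,
    le_min_iff, Int.ceil_le, Int.le_floor]
  constructor
  · rintro ⟨j, ⟨⟨h0, h1⟩, h2, h3⟩, rfl⟩
    refine ⟨⟨j.toNat, by omega, by omega⟩, ?_, ?_⟩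
    · push_cast; linarith
    · push_cast; linarith
  · rintro ⟨⟨j, hj, rfl⟩, h1, h2⟩
    push_cast at h1 h2
    refine ⟨j, ⟨⟨by omega, ?_⟩, by omega, ?_⟩, rfl⟩
    · push_cast; linarith
    · push_cast; linarith

/-- The points have spacing 2. The bound does not involve `q`, which is what keeps the tree search
independent of the constellation size. -/
lemma card_pamInterval_le {q : ℕ} {lo hi : ℝ} (h : lo ≤ hi) :
    ((pamInterval q lo hi).card : ℝ) ≤ (hi - lo) / 2 + 1 := by
  have h1 : (pamInterval q lo hi).card ≤ _ := Finset.card_image_le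
  rw [Int.card_Icc] at h1
  have h2 : ((pamInterval q lo hi).card : ℝ) ≤ _ := Nat.cast_le.2 h1
  refine h2.trans ?_
  set x := max 0 ⌈(lo + ((q : ℝ) - 1)) / 2⌉
  set y := min ((q : ℤ) - 1) ⌊(hi + ((q : ℝ) - 1)) / 2⌋
  have hx : (lo + ((q : ℝ) - 1)) / 2 ≤ x := Int.ceil_le.1 (le_max_right _ _)
  have hy : (y : ℝ) ≤ (hi + ((q : ℝ) - 1)) / 2 := Int.le_floor.1 (min_le_right _ _)
  rcases le_total (y + 1 - x) 0 with h0 | h0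
  · rw [Int.toNat_of_nonpos h0]
    simp only [Nat.cast_zero]
    linarith
  · have : (((y + 1 - x).toNat : ℤ) : ℝ) = ((y + 1 - x : ℤ) : ℝ) := by
      rw [Int.toNat_of_nonneg h0]
    rw [Int.cast_natCast] at this
    rw [this]
    push_cast
    linarith

/-! ### The tree search -/

section Search

variable {r : ℕ} {R : Matrix (Fin r) (Fin r) ℝ} {q : ℕ} {z : Fin r → ℝ}

/-- The interval is exactly the condition that the residual of the row fits into the remaining
budget. `0 ≤ b` is essential, since the square root of a negative number is `0`. -/
lemma mem_children {R e b : ℝ} (hR : R ≠ 0) (hb : 0 ≤ b) {a : ℤ} :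
    a ∈ pamInterval q (e / R - √b / |R|) (e / R + √b / |R|) ↔
      a ∈ pam q ∧ (e - R * a) ^ 2 ≤ b := by
  rw [mem_pamInterval]
  refine and_congr_right fun _ => ?_
  have h1 : (e - R * a) ^ 2 ≤ b ↔ |e - R * a| ≤ √b := by
    rw [← sq_abs]
    exact (Real.le_sqrt (abs_nonneg _) hb).symm
  have h2 : e - R * a = R * (e / R - a) := by field_simp
  rw [h1, h2, abs_mul, mul_comm, ← le_div_iff₀ (abs_pos.2 hR), abs_le]
  constructor
  · rintro ⟨h3, h4⟩; constructor <;> linarith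
  · rintro ⟨h3, h4⟩; constructor <;> linarith

lemma mulVec_apply_of_upper (hup : ∀ i j, j < i → R i j = 0) (s : Fin r → ℝ) (k : Fin r) :
    (R *ᵥ s) k = R k k * s k + ∑ j ∈ Finset.Ioi k, R k j * s j := by
  rw [mulVec, dotProduct, ← Finset.sum_subset (Finset.subset_univ (Finset.Ici k)),
    ← Finset.Ioi_insert, Finset.sum_insert (by simp)]
  intro j _ hj
  rw [hup k j (by simpa using hj), zero_mul]

/-- The rows of index at least `i` have already been charged to `b`. Since `R` is upper triangular,
row `i` involves only entries fixed at the node or chosen for the child, so its residual is known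
there; `mem_children` keeps the budget nonnegative. -/
lemma mem_search (hup : ∀ i j, j < i → R i j = 0) (hdiag : ∀ i, R i i ≠ 0) :
    ∀ (i : ℕ) (h : i ≤ r) (s : Fin r → ℤ) (b : ℝ), 0 ≤ b → ∀ s' : Fin r → ℤ,
      s' ∈ (search R q z i h s b).1 ↔
        (∀ j : Fin r, i ≤ j → s' j = s j) ∧ (∀ j : Fin r, (j : ℕ) < i → s' j ∈ pam q) ∧
          ∑ k with (k : Fin r).val < i, (z k - (R *ᵥ fun j => (s' j : ℝ)) k) ^ 2 ≤ b
  | 0, h, s, b, hb, s' => by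
    simp only [search, Finset.mem_singleton, Nat.zero_le, true_imp_iff, Nat.not_lt_zero,
      false_imp_iff, Finset.filter_false, Finset.sum_empty, hb, and_true, implies_true]
    exact funext_iff
  | i + 1, h, s, b, hb, s' => by
    let k : Fin r := ⟨i, h⟩
    have hsum : ∑ l with (l : Fin r).val < i + 1, (z l - (R *ᵥ fun j => (s' j : ℝ)) l) ^ 2
        = (z k - (R *ᵥ fun j => (s' j : ℝ)) k) ^ 2
          + ∑ l with (l : Fin r).val < i, (z l - (R *ᵥ fun j => (s' j : ℝ)) l) ^ 2 := by
      have : Finset.univ.filter (fun l : Fin r => l.val < i + 1)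
          = insert k (Finset.univ.filter fun l : Fin r => l.val < i) := by
        ext l
        simp only [Finset.mem_filter, Finset.mem_univ, true_and, Finset.mem_insert, Fin.ext_iff, k]
        omega
      rw [this, Finset.sum_insert (by simp [k])]
    have hrow : (∀ j : Fin r, i + 1 ≤ j → s' j = s j) →
        z k - (R *ᵥ fun j => (s' j : ℝ)) k
          = (z k - ∑ j ∈ Finset.Ioi k, R k j * (s j : ℝ)) - R k k * (s' k : ℝ) := by
      intro hs
      rw [mulVec_apply_of_upper hup,
        Finset.sum_congr rfl (g := fun j => R k j * (s j : ℝ)) fun j hj => by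
          rw [hs j (Finset.mem_Ioi.1 hj)]]
      ring
    simp only [search, Finset.mem_biUnion]
    rw [hsum]
    constructor
    · rintro ⟨a, ha, hs'⟩
      have ha' := (mem_children (hdiag k) hb).1 ha
      rw [mem_search hup hdiag i _ _ _ (sub_nonneg.2 ha'.2)] at hs'
      obtain ⟨h1, h2, h3⟩ := hs'
      have hk : s' k = a := by simpa [k] using h1 k le_rfl
      have h1' : ∀ j : Fin r, i + 1 ≤ j → s' j = s j := by
        intro j hj
        rw [h1 j (by omega), Function.update_of_ne]
        rintro rfl
        simp at hj
      refine ⟨h1', fun j hj => ?_, ?_⟩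
      · rcases Nat.lt_succ_iff_lt_or_eq.1 hj with hj | hj
        · exact h2 j hj
        · rw [show j = k from Fin.ext hj, hk]
          exact ha'.1
      · rw [hrow h1', hk]
        linarith
    · rintro ⟨h1, h2, h3⟩
      rw [hrow h1] at h3
      have hnn : 0 ≤ ∑ l with (l : Fin r).val < i, (z l - (R *ᵥ fun j => (s' j : ℝ)) l) ^ 2 :=
        Finset.sum_nonneg fun _ _ => sq_nonneg _
      have hle : (z k - ∑ j ∈ Finset.Ioi k, R k j * (s j : ℝ) - R k k * (s' k : ℝ)) ^ 2 ≤ b := by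
        linarith
      refine ⟨s' k, (mem_children (hdiag k) hb).2 ⟨h2 k (Nat.lt_succ_self i), hle⟩, ?_⟩
      rw [mem_search hup hdiag i _ _ _ (sub_nonneg.2 hle)]
      refine ⟨fun j hj => ?_, fun j hj => h2 j (by omega), by linarith⟩
      by_cases hjk : j = k
      · subst hjk; exact (Function.update_self k (s' k) s).symm
      · have : (j : ℕ) ≠ i := fun h => hjk (Fin.ext h)
        rw [h1 j (by omega)]
        exact (Function.update_of_ne hjk _ _).symm

/-- A node has at most `1 + κρ` children. Base `2 + κρ` leaves room for the node itself: `1 + (x -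
1) xⁱ ≤ xⁱ⁺¹` for `x ≥ 1`. -/
lemma search_nodes_le {κ ρ : ℝ} (hκ : ∀ k, |R k k|⁻¹ ≤ κ) (hρ : 0 ≤ ρ) :
    ∀ (i : ℕ) (h : i ≤ r) (s : Fin r → ℤ) (b : ℝ), b ≤ ρ ^ 2 →
      ((search R q z i h s b).2 : ℝ) ≤ (2 + κ * ρ) ^ i
  | 0, h, s, b, hb => by simp [search]
  | i + 1, h, s, b, hb => by
    let k : Fin r := ⟨i, h⟩
    have hκ0 : 0 ≤ κ := (inv_nonneg.2 (abs_nonneg _)).trans (hκ k)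
    simp only [search]
    push_cast
    set e : ℝ := z k - ∑ j ∈ Finset.Ioi k, R k j * (s j : ℝ)
    set ch := pamInterval q (e / R k k - √b / |R k k|) (e / R k k + √b / |R k k|) with hch
    have hd : 0 ≤ √b / |R k k| := by positivity
    have hcard : (ch.card : ℝ) ≤ 1 + κ * ρ := by
      have h1 : (ch.card : ℝ) ≤ _ := card_pamInterval_le (by linarith)
      have h2 : √b / |R k k| ≤ κ * ρ := by
        rw [div_eq_mul_inv, mul_comm]
        exact mul_le_mul (hκ k) (Real.sqrt_le_iff.2 ⟨hρ, hb⟩) (Real.sqrt_nonneg _) hκ0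
      linarith
    have hsum : ∑ a ∈ ch, ((search R q z i (Nat.le_of_succ_le h) (Function.update s k a)
        (b - (e - R k k * (a : ℝ)) ^ 2)).2 : ℝ) ≤ ch.card * (2 + κ * ρ) ^ i := by
      rw [← nsmul_eq_mul]
      refine Finset.sum_le_card_nsmul _ _ _ fun a _ => search_nodes_le hκ hρ i _ _ _ ?_
      nlinarith [sq_nonneg (e - R k k * (a : ℝ))]
    have hx : 1 ≤ 2 + κ * ρ := by nlinarith [mul_nonneg hκ0 hρ]
    have hp : 1 ≤ (2 + κ * ρ) ^ i := one_le_pow₀ hx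
    refine (add_le_add_right hsum 1).trans ?_
    rw [pow_succ]
    nlinarith

end Search

/-! ### The sphere decoder -/

namespace QR

variable {m ι : Type*} [Fintype m] {G : Matrix m ι ℝ}

lemma mem_condSearch (D : QR G) {q : ℕ} {y : m → ℝ} {ρ : ℝ} {sb : Fin D.c → ℤ}
    {sa : Fin D.r → ℤ} :
    sa ∈ (D.condSearch q y ρ sb).1 ↔
      sa ∈ signalSet (Fin D.r) q ∧ D.metric y (sb, sa) ≤ ρ ^ 2 := by
  rw [condSearch, mem_search D.upper D.diag_ne_zero _ _ _ _ (sq_nonneg ρ), mem_signalSet]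
  have hf : Finset.univ.filter (fun k : Fin D.r => k.val < D.r) = Finset.univ := by simp
  rw [hf]
  constructor
  · rintro ⟨-, h2, h3⟩
    exact ⟨fun j => h2 j j.2, h3⟩
  · rintro ⟨h2, h3⟩
    exact ⟨fun j hj => absurd j.2 (by omega), fun j _ => h2 j, h3⟩

lemma mem_found (D : QR G) {q : ℕ} {y : m → ℝ} {ρ : ℝ} {p : (Fin D.c → ℤ) × (Fin D.r → ℤ)} :
    p ∈ D.found q y ρ ↔ p.1 ∈ signalSet (Fin D.c) q ∧ p.2 ∈ signalSet (Fin D.r) q ∧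
      D.metric y p ≤ ρ ^ 2 := by
  simp only [found, Finset.mem_biUnion, Finset.mem_image, mem_condSearch]
  constructor
  · rintro ⟨sb, h1, sa, h2, rfl⟩
    exact ⟨h1, h2⟩
  · rintro ⟨h1, h2⟩
    exact ⟨p.1, h1, p.2, h2, rfl⟩

lemma nodes_le (D : QR G) {κ ρ : ℝ} (hκ : ∀ k, |D.Ra k k|⁻¹ ≤ κ) (hρ : 0 ≤ ρ) (hκ0 : 0 ≤ κ)
    (q : ℕ) (y : m → ℝ) :
    (D.nodes q y ρ : ℝ) ≤ (q : ℝ) ^ D.c * (2 + κ * ρ) ^ D.r := by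
  rw [nodes]
  push_cast
  refine (Finset.sum_le_card_nsmul _ _ _ fun sb _ => search_nodes_le hκ hρ _ _ _ _ le_rfl).trans ?_
  rw [nsmul_eq_mul]
  have : ((signalSet (Fin D.c) q).card : ℝ) ≤ (q : ℝ) ^ D.c := by
    exact_mod_cast card_signalSet_le D.c q
  gcongr

/-- Ensures that the infimum in `doublings` is attained, rather than being the default `0` of an
empty set. -/
lemma exists_found_nonempty (D : QR G) {q : ℕ} (hq : 1 ≤ q) {ρ₀ : ℝ} (hρ₀ : 0 < ρ₀) (y : m → ℝ) :
    {n : ℕ | (D.found q y (2 ^ n * ρ₀)).Nonempty}.Nonempty := by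
  obtain ⟨a, ha⟩ := pam_nonempty hq
  let p : (Fin D.c → ℤ) × (Fin D.r → ℤ) := (fun _ => a, fun _ => a)
  -- The summand 1 makes the radius exceed 1, so that its square also exceeds the metric.
  obtain ⟨n, hn⟩ := pow_unbounded_of_one_lt ((1 + D.metric y p) / ρ₀) one_lt_two
  refine ⟨n, p, D.mem_found.2 ⟨mem_signalSet.2 fun _ => ha, mem_signalSet.2 fun _ => ha, ?_⟩⟩
  rw [div_lt_iff₀ hρ₀] at hn
  have h0 : 0 ≤ D.metric y p := Finset.sum_nonneg fun _ _ => sq_nonneg _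
  nlinarith

lemma found_doublings_nonempty (D : QR G) {q : ℕ} (hq : 1 ≤ q) {ρ₀ : ℝ} (hρ₀ : 0 < ρ₀)
    (y : m → ℝ) : (D.found q y (2 ^ D.doublings q ρ₀ y * ρ₀)).Nonempty :=
  Nat.sInf_mem (D.exists_found_nonempty hq hρ₀ y)

/-- The entries `(s_b, s_a)` of a symbol vector. -/
def split (D : QR G) (s : ι → ℤ) : (Fin D.c → ℤ) × (Fin D.r → ℤ) :=
  (fun i => s (D.order (Sum.inr i)), fun i => s (D.order (Sum.inl i)))

/-- The symbol vector with the entries `(s_b, s_a)`. -/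
def join (D : QR G) (p : (Fin D.c → ℤ) × (Fin D.r → ℤ)) : ι → ℤ :=
  fun i => Sum.elim p.2 p.1 (D.order.symm i)

lemma split_join (D : QR G) (p : (Fin D.c → ℤ) × (Fin D.r → ℤ)) : D.split (D.join p) = p := by
  ext <;> simp [split, join]

lemma dotProduct_mulVec_Q (D : QR G) (u v : Fin D.r → ℝ) : D.Q *ᵥ u ⬝ᵥ D.Q *ᵥ v = u ⬝ᵥ v := by
  rw [dotProduct_mulVec, vecMul_mulVec, D.orthonormal, vecMul_one]

lemma isUnit_Ra (D : QR G) : IsUnit D.Ra := by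
  rw [isUnit_iff_isUnit_det, det_of_isUpperTriangular (fun i j h => D.upper i j h), isUnit_iff_ne_zero]
  exact Finset.prod_ne_zero_iff.2 fun i _ => D.diag_ne_zero i

/-- The columns of `Q Ra` are columns of `G` and `Ra` is invertible, so a vector orthogonal to the
columns of `G` is orthogonal to those of `Q`. -/
lemma transpose_mulVec_eq_zero (D : QR G) {x : m → ℝ} (hx : Gᵀ *ᵥ x = 0) : D.Qᵀ *ᵥ x = 0 := by
  have h1 : D.Raᵀ *ᵥ (D.Qᵀ *ᵥ x) = 0 := by
    ext i
    have h2 := congrFun hx (D.order (Sum.inl i))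
    have h3 : (D.Q * D.Ra)ᵀ i = Gᵀ (D.order (Sum.inl i)) := by
      ext k
      have := congrFun (congrFun D.factorization k) (Sum.inl i)
      rw [mul_fromCols] at this
      exact this.symm
    rw [mulVec_mulVec, ← transpose_mul, mulVec, h3]
    exact h2
  exact mulVec_injective_of_isUnit ((isUnit_transpose _).2 D.isUnit_Ra) (h1.trans (mulVec_zero _).symm)

variable [Fintype ι]

lemma mulVec_eq (D : QR G) (s : ι → ℤ) :
    (G *ᵥ fun i => (s i : ℝ)) = D.Q *ᵥ ((D.Ra *ᵥ fun i => ((D.split s).2 i : ℝ))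
      + D.Rb *ᵥ fun i => ((D.split s).1 i : ℝ)) := by
  have h1 : (G *ᵥ fun i => (s i : ℝ))
      = G.submatrix id D.order *ᵥ ((fun i => (s i : ℝ)) ∘ D.order) := by
    rw [submatrix_mulVec_equiv, Function.comp_id, Function.comp_assoc, Equiv.self_comp_symm,
      Function.comp_id]
  have h2 : (fun i => (s i : ℝ)) ∘ D.order = Sum.elim (fun i => ((D.split s).2 i : ℝ))
      (fun i => ((D.split s).1 i : ℝ)) := by
    ext (i | i) <;> rfl
  rw [h1, D.factorization, ← mulVec_mulVec, h2, fromCols_mulVec_sumElim]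

/-- Pythagoras: the decoder metric and the full squared distance differ by the part of `y` outside
the range of `Q`, which does not depend on `s`. -/
lemma metric_eq (D : QR G) (y : m → ℝ) (s : ι → ℤ) :
    D.metric y (D.split s) = (y - G *ᵥ fun i => (s i : ℝ)) ⬝ᵥ (y - G *ᵥ fun i => (s i : ℝ))
      - (y ⬝ᵥ y - (D.Qᵀ *ᵥ y) ⬝ᵥ (D.Qᵀ *ᵥ y)) := by
  rw [D.mulVec_eq s]
  set u := (D.Ra *ᵥ fun i => ((D.split s).2 i : ℝ)) + D.Rb *ᵥ fun i => ((D.split s).1 i : ℝ) with hu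
  have h1 : D.metric y (D.split s) = (D.Qᵀ *ᵥ y - u) ⬝ᵥ (D.Qᵀ *ᵥ y - u) := by
    rw [metric, dotProduct]
    refine Finset.sum_congr rfl fun k _ => ?_
    rw [sq, hu]
    simp only [Pi.sub_apply, Pi.add_apply]
    ring
  have h2 : y ⬝ᵥ D.Q *ᵥ u = (D.Qᵀ *ᵥ y) ⬝ᵥ u := by
    rw [dotProduct_mulVec, mulVec_transpose]
  rw [h1]
  simp only [sub_dotProduct, dotProduct_sub, D.dotProduct_mulVec_Q]
  rw [dotProduct_comm (D.Q *ᵥ u) y, dotProduct_comm u, h2]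
  ring

lemma split_mem (D : QR G) [DecidableEq ι] {q : ℕ} {s : ι → ℤ} (hs : s ∈ signalSet ι q) :
    (D.split s).1 ∈ signalSet (Fin D.c) q ∧ (D.split s).2 ∈ signalSet (Fin D.r) q :=
  ⟨mem_signalSet.2 fun _ => mem_signalSet.1 hs _, mem_signalSet.2 fun _ => mem_signalSet.1 hs _⟩

lemma exists_decode (D : QR G) [DecidableEq ι] {q : ℕ} (hq : 1 ≤ q) {ρ₀ : ℝ} (hρ₀ : 0 < ρ₀)
    (y : m → ℝ) :
    ∃ s ∈ signalSet ι q, D.decode q ρ₀ y = some s ∧ ∀ s' ∈ signalSet ι q,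
      (y - G *ᵥ fun i => (s i : ℝ)) ⬝ᵥ (y - G *ᵥ fun i => (s i : ℝ))
        ≤ (y - G *ᵥ fun i => (s' i : ℝ)) ⬝ᵥ (y - G *ᵥ fun i => (s' i : ℝ)) := by
  set S := D.found q y (2 ^ D.doublings q ρ₀ y * ρ₀) with hS
  obtain ⟨p, hp⟩ : ∃ p, S.toList.argmin (D.metric y) = some p := by
    rw [← Option.ne_none_iff_exists']
    intro h
    rw [List.argmin_eq_none, Finset.toList_eq_nil] at h
    exact (D.found_doublings_nonempty hq hρ₀ y).ne_empty h
  have hpS := D.mem_found.1 (Finset.mem_toList.1 (List.argmin_mem hp))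
  refine ⟨D.join p, mem_signalSet.2 fun i => ?_, ?_, fun s' hs' => ?_⟩
  · rw [join]
    rcases D.order.symm i with j | j
    · exact mem_signalSet.1 hpS.2.1 j
    · exact mem_signalSet.1 hpS.1 j
  · rw [decode, ← hS, hp]
    rfl
  · have h1 := D.metric_eq y (D.join p)
    have h2 := D.metric_eq y s'
    rw [split_join] at h1
    have h3 : D.metric y p ≤ D.metric y (D.split s') := by
      -- A vector outside the sphere cannot beat one inside, so the best vector found is the best of
      -- all.
      by_cases hmem : D.split s' ∈ S
      · exact List.le_of_mem_argmin (Finset.mem_toList.2 hmem) hp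
      · by_contra! hlt
        refine hmem (D.mem_found.2 ⟨(D.split_mem hs').1, (D.split_mem hs').2, ?_⟩)
        exact hlt.le.trans hpS.2.2
    linarith

/-- The residual of the transmitted vector is `Qᵀ w`, and Bessel's inequality bounds it by the
noise. Here `x` stands for the interference of the other group. -/
lemma metric_transmitted_le (D : QR G) {x w : m → ℝ} (hx : Gᵀ *ᵥ x = 0) (s : ι → ℤ) :
    D.metric ((G *ᵥ fun i => (s i : ℝ)) + x + w) (D.split s) ≤ w ⬝ᵥ w := by
  have hQx := D.transpose_mulVec_eq_zero hx
  set v := (D.Ra *ᵥ fun i => ((D.split s).2 i : ℝ)) + D.Rb *ᵥ fun i => ((D.split s).1 i : ℝ) with hv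
  have h1 : D.metric ((G *ᵥ fun i => (s i : ℝ)) + x + w) (D.split s)
      = (D.Qᵀ *ᵥ w) ⬝ᵥ (D.Qᵀ *ᵥ w) := by
    rw [metric, dotProduct]
    refine Finset.sum_congr rfl fun k _ => ?_
    have h2 : D.Qᵀ *ᵥ ((G *ᵥ fun i => (s i : ℝ)) + x + w) = v + D.Qᵀ *ᵥ w := by
      rw [D.mulVec_eq s, ← hv, mulVec_add, mulVec_add, hQx, mulVec_mulVec, D.orthonormal,
        one_mulVec, add_zero]
    rw [h2, sq, hv]
    simp only [Pi.sub_apply, Pi.add_apply]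
    ring
  rw [h1]
  set u := D.Qᵀ *ᵥ w with hu
  have h2 : w ⬝ᵥ D.Q *ᵥ u = u ⬝ᵥ u := by
    rw [dotProduct_mulVec, hu, mulVec_transpose]
  have h3 : 0 ≤ (w - D.Q *ᵥ u) ⬝ᵥ (w - D.Q *ᵥ u) :=
    Finset.sum_nonneg fun _ _ => mul_self_nonneg _
  simp only [sub_dotProduct, dotProduct_sub, D.dotProduct_mulVec_Q] at h3
  rw [dotProduct_comm (D.Q *ᵥ u) w, h2] at h3
  linarith

/-- The last unsuccessful radius is below `δ`, otherwise the transmitted vector would have been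
found; the final radius is twice that, or `ρ₀` if there was no doubling. -/
lemma two_pow_doublings_le (D : QR G) [DecidableEq ι] {q : ℕ} {ρ₀ δ : ℝ} (hρ₀ : 0 < ρ₀)
    (hδ : 0 ≤ δ) {y : m → ℝ} {s : ι → ℤ} (hs : s ∈ signalSet ι q)
    (hy : D.metric y (D.split s) ≤ δ ^ 2) : 2 ^ D.doublings q ρ₀ y * ρ₀ ≤ ρ₀ + 2 * δ := by
  rcases Nat.eq_zero_or_pos (D.doublings q ρ₀ y) with h0 | h0
  · rw [h0]; linarith
  · obtain ⟨d, hd⟩ : ∃ d, D.doublings q ρ₀ y = d + 1 := ⟨_, (Nat.sub_add_cancel h0).symm⟩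
    have h1 : d < sInf {n : ℕ | (D.found q y (2 ^ n * ρ₀)).Nonempty} := by
      change d < D.doublings q ρ₀ y
      omega
    have h2 := Nat.notMem_of_lt_sInf h1
    have h3 : 2 ^ d * ρ₀ < δ := by
      by_contra! h
      exact h2 ⟨D.split s, D.mem_found.2 ⟨(D.split_mem hs).1, (D.split_mem hs).2,
        hy.trans (pow_le_pow_left₀ hδ h 2)⟩⟩
    rw [hd, pow_succ]
    linarith

lemma exists_cost_le (D : QR G) [DecidableEq ι] {ρ₀ : ℝ} (hρ₀ : 0 < ρ₀) :
    ∃ K : ℝ, 1 ≤ K ∧ ∀ (q : ℕ) (s : ι → ℤ), s ∈ signalSet ι q → ∀ x w : m → ℝ, Gᵀ *ᵥ x = 0 →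
      ∀ δ : ℝ, 0 ≤ δ → w ⬝ᵥ w ≤ δ ^ 2 →
        (D.cost q ρ₀ ((G *ᵥ fun i => (s i : ℝ)) + x + w) : ℝ)
          ≤ (q : ℝ) ^ D.c * (K * (1 + δ)) ^ (D.r + 1) := by
  let κ : ℝ := ∑ k, |D.Ra k k|⁻¹
  have hκ : ∀ k, |D.Ra k k|⁻¹ ≤ κ := fun k =>
    Finset.single_le_sum (f := fun k => |D.Ra k k|⁻¹) (fun _ _ => by positivity) (Finset.mem_univ k)
  have hκ0 : 0 ≤ κ := Finset.sum_nonneg fun _ _ => by positivity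
  -- The constant is chosen so that `K (1 + δ)` bounds both the branching base at the final radius
  -- and the number of radii tried, `d + 1 ≤ 2 ^ d ≤ 1 + 2δ/ρ₀`. Hence the exponent: `r` for the
  -- tree and one more for the radii.
  refine ⟨2 + 2 / ρ₀ + κ * ρ₀ + 2 * κ, ?_, fun q s hs x w hx δ hδ hw => ?_⟩
  · have : 0 ≤ 2 / ρ₀ + κ * ρ₀ + 2 * κ := by positivity
    linarith
  set y := (G *ᵥ fun i => (s i : ℝ)) + x + w
  set K := 2 + 2 / ρ₀ + κ * ρ₀ + 2 * κ with hK
  set d := D.doublings q ρ₀ y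
  have hd : 2 ^ d * ρ₀ ≤ ρ₀ + 2 * δ :=
    D.two_pow_doublings_le hρ₀ hδ hs ((D.metric_transmitted_le hx s).trans hw)
  have h1 : 2 + κ * (2 ^ d * ρ₀) ≤ K * (1 + δ) := by
    have h2 : κ * (2 ^ d * ρ₀) ≤ κ * (ρ₀ + 2 * δ) := mul_le_mul_of_nonneg_left hd hκ0
    have h3 : 0 ≤ 2 / ρ₀ * (1 + δ) + κ * ρ₀ * δ + 2 * δ + 2 * κ := by positivity
    have h4 : K * (1 + δ) = 2 + κ * (ρ₀ + 2 * δ) +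
      (2 / ρ₀ * (1 + δ) + κ * ρ₀ * δ + 2 * δ + 2 * κ) := by rw [hK]; ring
    linarith
  have h2 : ((d + 1 : ℕ) : ℝ) ≤ K * (1 + δ) := by
    have h3 : ((d + 1 : ℕ) : ℝ) ≤ 2 ^ d := by exact_mod_cast Nat.lt_two_pow_self
    have h4 : (2 : ℝ) ^ d ≤ 1 + 2 / ρ₀ * δ := by
      rw [← le_div_iff₀ hρ₀] at hd
      refine hd.trans_eq ?_
      field_simp
    have h5 : 0 ≤ 1 + 2 / ρ₀ + κ * ρ₀ * (1 + δ) + 2 * κ * (1 + δ) + 2 * δ := by positivity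
    have h6 : K * (1 + δ) = 1 + 2 / ρ₀ * δ +
      (1 + 2 / ρ₀ + κ * ρ₀ * (1 + δ) + 2 * κ * (1 + δ) + 2 * δ) := by rw [hK]; ring
    linarith
  have h0 : 0 ≤ 2 + κ * (2 ^ d * ρ₀) := by positivity
  rw [cost]
  push_cast
  have h3 : ∀ n ∈ Finset.range (d + 1), (D.nodes q y (2 ^ n * ρ₀) : ℝ)
      ≤ (q : ℝ) ^ D.c * (K * (1 + δ)) ^ D.r := by
    intro n hn
    refine (D.nodes_le hκ (by positivity) hκ0 q y).trans ?_
    have hnd : (2 : ℝ) ^ n ≤ 2 ^ d :=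
      pow_le_pow_right₀ one_le_two (Nat.lt_succ_iff.1 (Finset.mem_range.1 hn))
    have : 2 + κ * (2 ^ n * ρ₀) ≤ K * (1 + δ) := by
      refine le_trans ?_ h1
      gcongr
    gcongr
  refine (Finset.sum_le_card_nsmul _ _ _ h3).trans ?_
  rw [Finset.card_range, nsmul_eq_mul, pow_succ]
  have h4 : 0 ≤ (q : ℝ) ^ D.c * (K * (1 + δ)) ^ D.r := by
    have : 0 ≤ K * (1 + δ) := h0.trans h1
    positivity
  calc ((d + 1 : ℕ) : ℝ) * ((q : ℝ) ^ D.c * (K * (1 + δ)) ^ D.r)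
      ≤ (K * (1 + δ)) * ((q : ℝ) ^ D.c * (K * (1 + δ)) ^ D.r) := mul_le_mul_of_nonneg_right h2 h4
    _ = _ := by ring

lemma r_add_c (D : QR G) : D.r + D.c = Fintype.card ι := by
  rw [← Fintype.card_congr D.order]; simp

lemma rank_le (D : QR G) : G.rank ≤ D.r := by
  have h : (G.submatrix id D.order).rank = G.rank := rank_submatrix G (Equiv.refl m) D.order
  rw [← h, D.factorization]
  exact (rank_mul_le_left _ _).trans ((rank_le_card_width _).trans_eq (Fintype.card_fin _))

end QR

end STBC

namespace STBC

open Matrix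

/-! ### Existence of QR decompositions -/

lemma inner_toLp_eq_dotProduct {m : Type*} [Fintype m] (v w : EuclideanSpace ℝ m) :
    inner ℝ v w = v.ofLp ⬝ᵥ w.ofLp := by
  rw [EuclideanSpace.inner_eq_star_dotProduct, star_trivial, dotProduct_comm]

/-- A maximal independent set of columns is moved to the front and orthonormalized by Gram-Schmidt.
It spans all columns, so the entries of `R` are inner products with the orthonormal vectors. -/
lemma nonempty_QR {m ι : Type*} [Fintype m] [Finite ι] (G : Matrix m ι ℝ) : Nonempty (QR G) := by
  classical
  let v : ι → EuclideanSpace ℝ m := fun j => WithLp.toLp 2 (G.col j)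
  obtain ⟨κ, a, ha, hspan, hli⟩ := exists_linearIndependent' ℝ v
  have : Finite κ := Finite.of_injective a ha
  let e : Fin (Nat.card κ) ≃ κ := (Finite.equivFin κ).symm
  let e' : Fin (Nat.card ((Set.range a)ᶜ : Set ι)) ≃ ((Set.range a)ᶜ : Set ι) :=
    (Finite.equivFin _).symm
  let order : Fin (Nat.card κ) ⊕ Fin (Nat.card ((Set.range a)ᶜ : Set ι)) ≃ ι :=
    (Equiv.sumCongr (e.trans (Equiv.ofInjective a ha)) e').trans (Equiv.Set.sumCompl (Set.range a))
  have horder : ∀ k, order (Sum.inl k) = a (e k) := fun k => rfl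
  let u : Fin (Nat.card κ) → EuclideanSpace ℝ m := v ∘ a ∘ e
  have hu : LinearIndependent ℝ u := hli.comp e e.injective
  let Q := InnerProductSpace.gramSchmidtNormed ℝ u
  have hQ : Orthonormal ℝ Q := InnerProductSpace.gramSchmidtNormed_orthonormal hu
  have hQspan : ∀ j, v j ∈ Submodule.span ℝ (Set.range Q) := by
    intro j
    rw [InnerProductSpace.span_gramSchmidtNormed_range, InnerProductSpace.span_gramSchmidt]
    have : Set.range u = Set.range (v ∘ a) := by
      rw [show u = (v ∘ a) ∘ e from rfl, e.surjective.range_comp]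
    rw [this, hspan]
    exact Submodule.subset_span ⟨j, rfl⟩
  have hrepr : ∀ j, ∑ k, inner ℝ (Q k) (v j) • Q k = v j := by
    intro j
    obtain ⟨c, hc⟩ := (Submodule.mem_span_range_iff_exists_fun ℝ).1 (hQspan j)
    rw [← hc]
    refine Finset.sum_congr rfl fun k _ => ?_
    rw [hQ.inner_right_fintype]
  refine ⟨⟨_, _, order, Matrix.of fun i k => Q k i, Matrix.of fun k l => inner ℝ (Q k) (u l),
    Matrix.of fun k l => inner ℝ (Q k) (v (order (Sum.inr l))), ?_, ?_, ?_, ?_⟩⟩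
  · ext i j
    have h := orthonormal_iff_ite.1 hQ i j
    rw [inner_toLp_eq_dotProduct] at h
    rw [Matrix.one_apply, ← h]
    rfl
  · intro i j hij
    change inner ℝ (Q i) (u j) = 0
    simp only [Q, InnerProductSpace.gramSchmidtNormed]
    rw [inner_smul_left, InnerProductSpace.gramSchmidt_inv_triangular ℝ u hij, mul_zero]
  · intro i
    change inner ℝ (Q i) (u i) ≠ 0
    simp only [Q, InnerProductSpace.gramSchmidtNormed]
    have hne := InnerProductSpace.gramSchmidt_ne_zero (𝕜 := ℝ) i hu
    -- A vector differs from its Gram-Schmidt image by a combination of earlier orthogonal vectors,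
    -- so the diagonal entry is a positive multiple of a squared norm.
    have h1 : inner ℝ (InnerProductSpace.gramSchmidt ℝ u i) (u i)
        = inner ℝ (InnerProductSpace.gramSchmidt ℝ u i) (InnerProductSpace.gramSchmidt ℝ u i) := by
      conv_lhs => rw [InnerProductSpace.gramSchmidt_def'' ℝ u i]
      rw [inner_add_right, inner_sum, Finset.sum_eq_zero, add_zero]
      intro j hj
      rw [inner_smul_right, InnerProductSpace.gramSchmidt_orthogonal ℝ u (Finset.mem_Iio.1 hj).ne',
        mul_zero]
    rw [inner_smul_left, h1, real_inner_self_eq_norm_sq]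
    simpa using hne
  · ext i l
    have h := congrArg (fun x : EuclideanSpace ℝ m => x.ofLp i) (hrepr (order l))
    simp only [WithLp.ofLp_sum, Finset.sum_apply, WithLp.ofLp_smul, Pi.smul_apply, smul_eq_mul] at h
    have h' : G i (order l) = _ := h.symm
    rw [submatrix_apply, id, h', Matrix.mul_apply]
    refine Finset.sum_congr rfl fun k _ => ?_
    rw [mul_comm]
    rcases l with l | l <;> rfl

/-! ### Orthogonality of the two groups -/

lemma vecTilde_dotProduct {m n : Type*} [Fintype m] [Fintype n] (X Y : Matrix m n ℂ) :
    vecTilde X ⬝ᵥ vecTilde Y = (Xᴴ * Y).trace.re := by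
  rw [dotProduct, Fintype.sum_sum_type, ← Finset.sum_add_distrib, Fintype.sum_prod_type, trace,
    Complex.re_sum]
  refine Finset.sum_congr rfl fun j _ => ?_
  rw [diag_apply, Matrix.mul_apply, Complex.re_sum]
  refine Finset.sum_congr rfl fun i _ => ?_
  simp [vecTilde, Matrix.vec, Complex.mul_re]

lemma vecTilde_dotProduct_self {m n : Type*} [Fintype m] [Fintype n] (X : Matrix m n ℂ) :
    vecTilde X ⬝ᵥ vecTilde X = ∑ i, ∑ j, ‖X i j‖ ^ 2 := by
  rw [dotProduct, Fintype.sum_sum_type, ← Finset.sum_add_distrib, Fintype.sum_prod_type,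
    Finset.sum_comm]
  refine Finset.sum_congr rfl fun i _ => Finset.sum_congr rfl fun j _ => ?_
  rw [Complex.sq_norm, Complex.normSq_apply]
  rfl

lemma vecTilde_dotProduct_eq_zero {m n : Type*} [Fintype m] [Fintype n] {X Y : Matrix m n ℂ}
    (h : Xᴴ * Y + Yᴴ * X = 0) : vecTilde X ⬝ᵥ vecTilde Y = 0 := by
  have h1 := congrArg (fun Z => (trace Z).re) h
  simp only [trace_add, Complex.add_re, trace_zero, Complex.zero_re, ← vecTilde_dotProduct] at h1
  rw [dotProduct_comm (vecTilde Y)] at h1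
  linarith

lemma conjTranspose_mul_eq_half {m n : Type*} [Fintype m] (X Y : Matrix (m ⊕ m) n ℂ) :
    Xᴴ * Y = (half 0 X)ᴴ * half 0 Y + (half 1 X)ᴴ * half 1 Y := by
  ext i j
  simp [Matrix.mul_apply, half, Fintype.sum_sum_type]

variable {N M T : ℕ} {F : Fin 2 → Matrix (Fin (T / 2)) (Fin N) ℂ}
  {A : Fin 2 × Fin (T * N - N ^ 2 + 1) → Matrix (Fin (T / 2) ⊕ Fin (T / 2)) (Fin N) ℂ}

/-- Hurwitz-Radon orthogonality adds up over the two halves and survives multiplication by `Hᴴ` and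
`H`; the real part of the trace turns it into orthogonality of real vectors. -/
lemma IsTwoGroupCode.groupChannel_orthogonal (h : IsTwoGroupCode F A)
    (H : Matrix (Fin N) (Fin M) ℂ) (g : Fin 2) :
    (groupChannel A H g)ᵀ * groupChannel A H (g + 1) = 0 := by
  have key : ∀ i j, vecTilde (A (0, i) * H) ⬝ᵥ vecTilde (A (1, j) * H) = 0 := by
    intro i j
    refine vecTilde_dotProduct_eq_zero ?_
    have h0 : (A (0, i))ᴴ * A (1, j) + (A (1, j))ᴴ * A (0, i) = 0 := by
      rw [conjTranspose_mul_eq_half, conjTranspose_mul_eq_half, add_add_add_comm, h.orthogonal,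
        h.orthogonal, add_zero]
    have h1 : (A (0, i) * H)ᴴ * (A (1, j) * H) + (A (1, j) * H)ᴴ * (A (0, i) * H)
        = Hᴴ * ((A (0, i))ᴴ * A (1, j) + (A (1, j))ᴴ * A (0, i)) * H := by
      simp only [conjTranspose_mul, Matrix.mul_add, Matrix.add_mul, Matrix.mul_assoc]
    rw [h1, h0, Matrix.mul_zero, Matrix.zero_mul]
  ext i j
  fin_cases g
  · exact key i j
  · exact (dotProduct_comm _ _).trans (key j i)

lemma vecTilde_add {m n : Type*} (X Y : Matrix m n ℂ) :
    vecTilde (X + Y) = vecTilde X + vecTilde Y := map_add (vecTildeLin m n) X Y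

lemma vecTilde_sub {m n : Type*} (X Y : Matrix m n ℂ) :
    vecTilde (X - Y) = vecTilde X - vecTilde Y := map_sub (vecTildeLin m n) X Y

lemma vecTilde_codeword_mul {τ : Type*} {L : ℕ} (A : Fin 2 × Fin L → Matrix τ (Fin N) ℂ)
    (Θ : Fin 2 → Matrix (Fin L) (Fin L) ℝ) (H : Matrix (Fin N) (Fin M) ℂ) (s : Fin 2 → Fin L → ℤ)
    (g : Fin 2) :
    vecTilde (codeword A Θ s * H) = ((groupChannel A H g * Θ g) *ᵥ fun i => (s g i : ℝ))
      + (groupChannel A H (g + 1) * Θ (g + 1)) *ᵥ fun i => (s (g + 1) i : ℝ) := by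
  have h : ∀ g, vecTilde ((∑ j, (Θ g *ᵥ fun i => (s g i : ℝ)) j • A (g, j)) * H)
      = (groupChannel A H g * Θ g) *ᵥ fun i => (s g i : ℝ) := by
    intro g
    rw [← mulVec_mulVec]
    exact (equivChannel_mulVec (fun j => A (g, j)) H _).symm
  rw [codeword, Fin.sum_univ_two, Matrix.add_mul, vecTilde_add, h, h]
  fin_cases g
  · rfl
  · exact add_comm _ _

lemma IsTwoGroupCode.mul_orthogonal (h : IsTwoGroupCode F A) (H : Matrix (Fin N) (Fin M) ℂ)
    (Θ : Fin 2 → Matrix (Fin (T * N - N ^ 2 + 1)) (Fin (T * N - N ^ 2 + 1)) ℝ) (g : Fin 2)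
    (v : Fin (T * N - N ^ 2 + 1) → ℝ) :
    (groupChannel A H g * Θ g)ᵀ *ᵥ ((groupChannel A H (g + 1) * Θ (g + 1)) *ᵥ v) = 0 := by
  rw [mulVec_mulVec, transpose_mul, ← Matrix.mul_assoc, Matrix.mul_assoc (Θ g)ᵀ,
    h.groupChannel_orthogonal, Matrix.mul_zero, Matrix.zero_mul, zero_mulVec]

/-- The metric of a joint symbol vector is the sum of the metrics of the groups, up to a constant. -/
lemma IsTwoGroupCode.sum_norm_sq (h : IsTwoGroupCode F A) (H : Matrix (Fin N) (Fin M) ℂ)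
    (Θ : Fin 2 → Matrix (Fin (T * N - N ^ 2 + 1)) (Fin (T * N - N ^ 2 + 1)) ℝ)
    (Y : Matrix (Fin (T / 2) ⊕ Fin (T / 2)) (Fin M) ℂ)
    (s : Fin 2 → Fin (T * N - N ^ 2 + 1) → ℤ) :
    ∑ t, ∑ j, ‖(Y - codeword A Θ s * H) t j‖ ^ 2
      = (∑ g, (vecTilde Y - (groupChannel A H g * Θ g) *ᵥ fun i => (s g i : ℝ))
        ⬝ᵥ (vecTilde Y - (groupChannel A H g * Θ g) *ᵥ fun i => (s g i : ℝ)))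
        - vecTilde Y ⬝ᵥ vecTilde Y := by
  rw [← vecTilde_dotProduct_self, vecTilde_sub, vecTilde_codeword_mul A Θ H s 0, Fin.sum_univ_two]
  have h1 := h.mul_orthogonal H Θ 0 fun i => (s 1 i : ℝ)
  have h2 : ((groupChannel A H 0 * Θ 0) *ᵥ fun i => (s 0 i : ℝ))
      ⬝ᵥ ((groupChannel A H 1 * Θ 1) *ᵥ fun i => (s 1 i : ℝ)) = 0 := by
    rw [dotProduct_comm, dotProduct_mulVec, ← mulVec_transpose]
    rw [zero_add] at h1
    rw [h1, zero_dotProduct]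
  rw [zero_add]
  set u := (groupChannel A H 0 * Θ 0) *ᵥ fun i => (s 0 i : ℝ)
  set w := (groupChannel A H 1 * Θ 1) *ᵥ fun i => (s 1 i : ℝ)
  have h3 := dotProduct_comm w u
  have h4 := dotProduct_comm u (vecTilde Y)
  have h5 := dotProduct_comm w (vecTilde Y)
  simp only [sub_dotProduct, dotProduct_sub, add_dotProduct, dotProduct_add]
  linarith

lemma IsTwoGroupCode.exists_decode (h : IsTwoGroupCode F A) (H : Matrix (Fin N) (Fin M) ℂ)
    (Θ : Fin 2 → Matrix (Fin (T * N - N ^ 2 + 1)) (Fin (T * N - N ^ 2 + 1)) ℝ)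
    (D : ∀ g, QR (groupChannel A H g * Θ g)) {ρ₀ : ℝ} (hρ₀ : 0 < ρ₀) {q : ℕ} (hq : 1 ≤ q)
    (Y : Matrix (Fin (T / 2) ⊕ Fin (T / 2)) (Fin M) ℂ) :
    ∃ s : Fin 2 → Fin (T * N - N ^ 2 + 1) → ℤ,
      (∀ g, (D g).decode q ρ₀ (vecTilde Y) = some (s g)) ∧ IsMLEstimate A Θ q H Y s := by
  choose s hs hdec hmin using fun g => (D g).exists_decode hq hρ₀ (vecTilde Y)
  refine ⟨s, hdec, hs, fun s' hs' => ?_⟩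
  rw [h.sum_norm_sq, h.sum_norm_sq]
  exact sub_le_sub_right (Finset.sum_le_sum fun g _ => hmin g _ (hs' g)) _

/-! ### Complexity -/

lemma vecTilde_dotProduct_self_le {m n : Type*} [Fintype m] [Fintype n] (W : Matrix m n ℂ) :
    vecTilde W ⬝ᵥ vecTilde W ≤ (∑ i, ∑ j, ‖W i j‖) ^ 2 := by
  rw [vecTilde_dotProduct_self, ← Fintype.sum_prod_type' (f := fun i j => ‖W i j‖ ^ 2),
    ← Fintype.sum_prod_type' (f := fun i j => ‖W i j‖)]
  exact Finset.sum_sq_le_sq_sum_of_nonneg fun _ _ => norm_nonneg _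

lemma IsTwoGroupCode.exists_complexity_le (h : IsTwoGroupCode F A) (H : Matrix (Fin N) (Fin M) ℂ)
    (Θ : Fin 2 → Matrix (Fin (T * N - N ^ 2 + 1)) (Fin (T * N - N ^ 2 + 1)) ℝ)
    (D : ∀ g, QR (groupChannel A H g * Θ g)) {ρ₀ : ℝ} (hρ₀ : 0 < ρ₀) {e : ℕ}
    (hc : ∀ g, (D g).c ≤ e) :
    ∃ C : ℝ≥0, ∀ q : ℕ, 1 ≤ q → ∀ s : Fin 2 → Fin (T * N - N ^ 2 + 1) → ℤ,
      (∀ g, s g ∈ signalSet (Fin (T * N - N ^ 2 + 1)) q) →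
      ∫⁻ W, ((∑ g, (D g).cost q ρ₀ (vecTilde (codeword A Θ s * H + W)) : ℕ) : ℝ≥0∞)
          ∂(gaussianMatrix (Fin (T / 2) ⊕ Fin (T / 2)) (Fin M)) ≤
        (C : ℝ≥0∞) * (q : ℝ≥0∞) ^ e := by
  choose K hK1 hK using fun g => (D g).exists_cost_le hρ₀
  -- One exponent for both groups: `r + 1` is at most the group size plus one.
  set l := T * N - N ^ 2 + 1 + 1 with hl
  have hr : ∀ g, (D g).r + 1 ≤ l := by
    intro g
    have := (D g).r_add_c
    rw [Fintype.card_fin] at this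
    omega
  let I := ∫⁻ W, ENNReal.ofReal ((1 + ∑ i, ∑ j, ‖W i j‖) ^ l)
    ∂(gaussianMatrix (Fin (T / 2) ⊕ Fin (T / 2)) (Fin M))
  have hI : I < ∞ := lintegral_norm_pow_lt_top l (by omega)
  let B : ℝ := ∑ g, K g ^ l
  refine ⟨B.toNNReal * I.toNNReal, fun q hq s hs => ?_⟩
  have hq' : (1 : ℝ) ≤ q := by exact_mod_cast hq
  have hpt : ∀ W : Matrix (Fin (T / 2) ⊕ Fin (T / 2)) (Fin M) ℂ,
      ((∑ g, (D g).cost q ρ₀ (vecTilde (codeword A Θ s * H + W)) : ℕ) : ℝ≥0∞)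
        ≤ ENNReal.ofReal (B * (q : ℝ) ^ e) * ENNReal.ofReal ((1 + ∑ i, ∑ j, ‖W i j‖) ^ l) := by
    intro W
    set δ := ∑ i, ∑ j, ‖W i j‖ with hδ
    have hδ0 : 0 ≤ δ := by positivity
    have hB : 0 ≤ B := Finset.sum_nonneg fun g _ => pow_nonneg (zero_le_one.trans (hK1 g)) _
    rw [← ENNReal.ofReal_mul (by positivity), ← ENNReal.ofReal_natCast]
    refine ENNReal.ofReal_le_ofReal ?_
    push_cast
    simp only [B]
    rw [Finset.sum_mul, Finset.sum_mul]
    refine Finset.sum_le_sum fun g _ => ?_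
    -- From the viewpoint of group `g`, the signal of the other group is the harmless term `x` of
    -- `exists_cost_le`.
    rw [vecTilde_add, vecTilde_codeword_mul A Θ H s g]
    refine (hK g q (s g) (hs g) _ _ (h.mul_orthogonal H Θ g _) δ hδ0
      (vecTilde_dotProduct_self_le W)).trans ?_
    have h1 : 1 ≤ K g * (1 + δ) := by nlinarith [hK1 g]
    calc (q : ℝ) ^ (D g).c * (K g * (1 + δ)) ^ ((D g).r + 1)
        ≤ (q : ℝ) ^ e * (K g * (1 + δ)) ^ l :=
          mul_le_mul (pow_le_pow_right₀ hq' (hc g)) (pow_le_pow_right₀ h1 (hr g)) (by positivity)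
            (by positivity)
      _ = _ := by rw [mul_pow]; ring
  refine (lintegral_mono hpt).trans_eq ?_
  rw [lintegral_const_mul' _ _ ENNReal.ofReal_ne_top, ENNReal.ofReal_mul' (by positivity),
    ENNReal.ofReal_pow (by positivity), ENNReal.ofReal_natCast, ENNReal.coe_mul,
    ENNReal.coe_toNNReal hI.ne]
  change ENNReal.ofReal B * _ * I = ENNReal.ofReal B * I * _
  ring

/-! ### The rank of the channel matrices -/

lemma finrank_arith {N M T : ℕ} (hT : Even T) (hNT : 2 * N ≤ T) (hMN : M ≤ N) :
    (N - M) ^ 2 + 2 * (T / 2 - N) * (N - M) = (N - M) * (T - N - M) := by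
  obtain ⟨t, rfl⟩ := hT
  obtain ⟨s, rfl⟩ : ∃ s, t = N + s := ⟨t - N, by omega⟩
  obtain ⟨d, rfl⟩ : ∃ d, N = M + d := ⟨N - M, by omega⟩
  have h1 : (M + d + s + (M + d + s)) / 2 - (M + d) = s := by omega
  have h2 : M + d + s + (M + d + s) - (M + d) - M = d + 2 * s := by omega
  have h3 : M + d - M = d := by omega
  rw [h1, h2, h3]
  ring

lemma rank_arith {N M T x : ℕ} (hT : Even T) (hNT : 2 * N ≤ T) (hMN : M ≤ N)
    (hx : x + ((N - M) ^ 2 + 2 * (T / 2 - N) * (N - M)) = T * N - N ^ 2 + 1) :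
    x = (T - 2 * N) * M + f N M + 1 := by
  rw [card_arith hT hNT] at hx
  obtain ⟨t, rfl⟩ := hT
  obtain ⟨s, rfl⟩ : ∃ s, t = N + s := ⟨t - N, by omega⟩
  obtain ⟨d, rfl⟩ : ∃ d, N = M + d := ⟨N - M, by omega⟩
  have h1 : (M + d + s + (M + d + s)) / 2 - (M + d) = s := by omega
  have h2 : M + d + s + (M + d + s) - 2 * (M + d) = 2 * s := by omega
  have h3 : M + d - M = d := by omega
  have h4 : f (M + d) M = M ^ 2 + 2 * M * d := by
    rw [f, h3]
    have : (M + d) ^ 2 = M ^ 2 + 2 * M * d + d ^ 2 := by ring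
    omega
  rw [h1, h3] at hx
  rw [h2, h4]
  nlinarith

lemma rate_eq (A : Fin 2 × Fin (T * N - N ^ 2 + 1) →
    Matrix (Fin (T / 2) ⊕ Fin (T / 2)) (Fin N) ℂ) (hN : 1 ≤ N) (hT : Even T) (hNT : 2 * N ≤ T) :
    rate A = (N : ℝ) - ((N : ℝ) ^ 2 - 1) / (T : ℝ) := by
  have hle : N ^ 2 ≤ T * N := by nlinarith
  have hT0 : (T : ℝ) ≠ 0 := Nat.cast_ne_zero.2 (by omega)
  have hcard : Fintype.card (Fin (T / 2) ⊕ Fin (T / 2)) = T := by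
    rw [Fintype.card_sum, Fintype.card_fin]
    obtain ⟨t, rfl⟩ := hT
    omega
  rw [rate, hcard, Fintype.card_prod, Fintype.card_fin, Fintype.card_fin]
  push_cast [Nat.cast_sub hle]
  field_simp
  ring

lemma rate_le (A : Fin 2 × Fin (T * N - N ^ 2 + 1) →
    Matrix (Fin (T / 2) ⊕ Fin (T / 2)) (Fin N) ℂ) (hN : 1 ≤ N) (hT : Even T) (hNT : 2 * N ≤ T) :
    rate A ≤ N := by
  rw [rate_eq A hN hT hNT]
  have h1 : (1 : ℝ) ≤ N := by exact_mod_cast hN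
  have : 0 ≤ ((N : ℝ) ^ 2 - 1) / (T : ℝ) := div_nonneg (by nlinarith) (Nat.cast_nonneg T)
  linarith

/-- Covers both regimes at once: for `M ≥ N` the truncated `N - M` is `0` and the rank is full. -/
lemma IsTwoGroupCode.card_le_rank_add (h : IsTwoGroupCode F A) (hN : 1 ≤ N) (hT : Even T)
    (hNT : 2 * N ≤ T) (hM : 1 ≤ M) :
    ∀ᵐ H ∂(gaussianMatrix (Fin N) (Fin M)), ∀ g,
      T * N - N ^ 2 + 1 ≤ (groupChannel A H g).rank + (N - M) * (T - N - M) := by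
  rcases lt_or_ge M N with hMN | hMN
  · filter_upwards [ae_mulVec_injective hMN.le] with H hH g
    have := h.rank_groupChannel hN hT hNT g hM hH
    rw [finrank_arith hT hNT hMN.le] at this
    exact this.ge
  · filter_upwards [ae_vecMul_injective hMN] with H hH g
    have h1 : (groupChannel A H g).rank = _ :=
      rank_equivChannel_eq_card (h.linearIndependent_group g) hH
    rw [Fintype.card_fin] at h1
    omega

lemma QR.c_le {m : Type*} [Fintype m] {L e : ℕ} {G : Matrix m (Fin L) ℝ}
    {Θ : Matrix (Fin L) (Fin L) ℝ} (hΘ : Θ.det ≠ 0) (hG : L ≤ G.rank + e) (D : QR (G * Θ)) :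
    D.c ≤ e := by
  have h1 := D.rank_le
  have h2 := D.r_add_c
  rw [rank_mul_eq_left_of_det_ne_zero Θ G hΘ] at h1
  rw [Fintype.card_fin] at h2
  omega

/-- For `M ≥ N` full and deficient rank would both hold almost surely, which a probability measure
excludes. -/
lemma IsTwoGroupCode.rankDeficient_iff (h : IsTwoGroupCode F A) (hN : 1 ≤ N) (hT : Even T)
    (hNT : 2 * N ≤ T) (hM : 1 ≤ M) : RankDeficient A M ↔ M < N := by
  constructor
  · intro hd
    by_contra! hMN
    have : ∀ᵐ H ∂(gaussianMatrix (Fin N) (Fin M)), False := by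
      filter_upwards [hd, ae_vecMul_injective hMN] with H h1 h2
      exact h1.ne (rank_equivChannel_eq_card h.linearIndependent h2)
    rw [ae_iff] at this
    simp at this
  · intro hMN
    filter_upwards [ae_mulVec_injective hMN.le] with H hH
    exact h.rank_equivChannel_lt hN hT hNT hM hMN hH

end STBC
theorem mainTheorem7 (N T : ℕ) (hN : 1 ≤ N) (hT : Even T) (hNT : 2 * N ≤ T) :
    -- codes of the family exist
    (∃ (F : Fin 2 → Matrix (Fin (T / 2)) (Fin N) ℂ)
      (A : Fin 2 × Fin (T * N - N ^ 2 + 1) → Matrix (Fin (T / 2) ⊕ Fin (T / 2)) (Fin N) ℂ),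
      IsTwoGroupCode F A) ∧
    ∀ (F : Fin 2 → Matrix (Fin (T / 2)) (Fin N) ℂ)
      (A : Fin 2 × Fin (T * N - N ^ 2 + 1) → Matrix (Fin (T / 2) ⊕ Fin (T / 2)) (Fin N) ℂ),
      IsTwoGroupCode F A →
      rate A = (N : ℝ) - ((N : ℝ) ^ 2 - 1) / (T : ℝ) ∧
      ∀ M : ℕ, 1 ≤ M →
        -- the rank of the channel submatrix of each group
        (M < N → ∀ᵐ H ∂(gaussianMatrix (Fin N) (Fin M)), ∀ g,
          (groupChannel A H g).rank = (T - 2 * N) * M + f N M + 1) ∧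
        -- singularity
        (IsSingular A M ↔ ⌈rate A⌉₊ ≤ M ∧ M < N) ∧
        (IsNonsingular A M ↔ N ≤ M) ∧
        -- groupwise sphere decoding: maximum likelihood, and its complexity
        ∀ᵐ H ∂(gaussianMatrix (Fin N) (Fin M)),
          ∀ Θ : Fin 2 → Matrix (Fin (T * N - N ^ 2 + 1)) (Fin (T * N - N ^ 2 + 1)) ℝ,
          (∀ g, (Θ g).det ≠ 0) →
          (∀ g, Nonempty (QR (groupChannel A H g * Θ g))) ∧
          ∀ (D : ∀ g, QR (groupChannel A H g * Θ g)) (ρ₀ : ℝ), 0 < ρ₀ →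
            (∀ q : ℕ, 1 ≤ q → ∀ Y : Matrix (Fin (T / 2) ⊕ Fin (T / 2)) (Fin M) ℂ,
              ∃ s : Fin 2 → Fin (T * N - N ^ 2 + 1) → ℤ,
                (∀ g, (D g).decode q ρ₀ (vecTilde Y) = some (s g)) ∧
                IsMLEstimate A Θ q H Y s) ∧
            ∃ C : ℝ≥0, ∀ q : ℕ, 1 ≤ q →
              ∀ s : Fin 2 → Fin (T * N - N ^ 2 + 1) → ℤ,
                (∀ g, s g ∈ signalSet (Fin (T * N - N ^ 2 + 1)) q) →
                ∫⁻ W, ((∑ g, (D g).cost q ρ₀ (vecTilde (codeword A Θ s * H + W)) : ℕ) : ℝ≥0∞)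
                    ∂(gaussianMatrix (Fin (T / 2) ⊕ Fin (T / 2)) (Fin M)) ≤
                  (C : ℝ≥0∞) * (q : ℝ≥0∞) ^ ((N - M) * (T - N - M)) := by
  refine ⟨exists_isTwoGroupCode hN hT hNT, fun F A h => ⟨rate_eq A hN hT hNT, fun M hM => ?_⟩⟩
  refine ⟨fun hMN => ?_, ?_, ?_, ?_⟩
  · filter_upwards [ae_mulVec_injective hMN.le] with H hH g
    exact rank_arith hT hNT hMN.le (h.rank_groupChannel hN hT hNT g hM hH)
  · rw [IsSingular, h.rankDeficient_iff hN hT hNT hM, Nat.ceil_le]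
  · rw [IsNonsingular, h.rankDeficient_iff hN hT hNT hM, not_lt]
    -- The rate never exceeds `N`, so `M ≥ R` is automatic here.
    exact and_iff_right_of_imp fun hMN => (rate_le A hN hT hNT).trans (Nat.cast_le.2 hMN)
  · filter_upwards [h.card_le_rank_add hN hT hNT hM] with H hH Θ hΘ
    exact ⟨fun g => nonempty_QR _, fun D ρ₀ hρ₀ =>
      ⟨fun q hq Y => h.exists_decode H Θ D hρ₀ hq Y,
        h.exists_complexity_le H Θ D hρ₀ fun g => (D g).c_le (hΘ g) (hH g)⟩⟩
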